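/- Let $n\ge 1$, $p\ge 0$ and $0\le\kappa\le n$ be integers with $2p\ge\kappa$, and let $0<\delta<n$. Let $s:\mathbb{R}^n\setminus\{0\}\to\mathbb{R}$ be smooth and such that $\lim_{h\to0^+}\int_{h<|x|\le1}s(x)\,dx$ exists in $\mathbb{R}$; $s(x)=|x|^{\delta-n}\rho(x/|x|)$ for all $x\ne0$, with a smooth function $\rho:\mathbb{R}^n\to\mathbb{R}$, $\rho\not\equiv0$; and $s$ is odd in each of the variables $x_1,\dots,x_\kappa$ and even in each of $x_{\kappa+1},\dots,x_n$. (Here $|\cdot|$ is the Euclidean norm.) For $h>0$ put $T_h^0[f]=h^n\sum_{\beta\in\mathbb{Z}^n\setminus\{0\}}f(\beta h)$. Let $$\mathcal I=\Big\{\beta\in\mathbb{Z}^n:\ \beta_j\ge0\ \text{for all } j,\ \sum_j\beta_j\le p,\ \prod_{1\le j\le\kappa}\beta_j\ne0\Big\},$$ for $\eta\in\mathcal I$ let $\mathcal G_\eta$ be the set of all $(\pm\eta_1,\dots,\pm\eta_n)$, and put $\sigma(\beta)=\operatorname{sgn}\big(\prod_{1\le j\le\kappa}\beta_j\big)$ and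 $\bar\xi=2\xi-\sum_{j=1}^{\kappa}e_j$ for $\xi\in\mathcal I$ (empty products are $1$, and $0^0=1$). Let $g$ be a real-valued, radially symmetric Schwartz function on $\mathbb{R}^n$ with $g(0)=1$ and $\partial^kg(0)=0$ for all multi-indices $k$ with $1\le|k|_1\le 2p-\kappa+1$. For $h>0$ consider the linear system $K\,G(h)\,\omega(h)=c(h)$ for $\omega(h)\in\mathbb{R}^{\mathcal I}$, where, for $\xi,\eta\in\mathcal I$, $$K_{\xi\eta}=\sum_{\beta\in\mathcal G_\eta}\sigma(\beta)\,\beta^{\bar\xi},\qquad G(h)=\operatorname{diag}\big(g(\eta h)\big)_{\eta\in\mathcal I},$$ $$c_\xi(h)=\frac{1}{h^{2|\xi|_1-\kappa+\delta}}\Big(\int_{\mathbb{R}^n}g(x)s(x)x^{\bar\xi}\,dx-T_h^0\big[g\,s\,x^{\bar\xi}\big]\Big).$$ Then these integrals and sums converge absolutely, and for all sufficiently small $h>0$ the system has exactly one solution $\omega(h)$. There is $\bar\omega\in\mathbb{R}^{\mathcal I}$ such that $\omega(h)\to\bar\omega$ and $$|\omega(h)-\bar\omega|_2=O\big(h^{2p-\kappa+2}\big)\qquad(h\to0^+).$$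 Moreover, let $\phi:\mathbb{R}^n\to\mathbb{R}$ be in $C_c^N(\mathbb{R}^n)$ for some integer $N>\max(2p-\kappa+2+\delta,\,n)$, or a Schwartz function, and let $$Q_h^p[\phi\cdot s]=T_h^0[\phi\cdot s]+h^\delta\sum_{\eta\in\mathcal I}\bar\omega_\eta\sum_{\beta\in\mathcal G_\eta}\sigma(\beta)\,\phi(\beta h).$$ Then $\phi\cdot s$ is integrable on $\mathbb{R}^n\setminus\{0\}$, the sum $T_h^0[\phi\cdot s]$ converges absolutely for every $h>0$, and there is $C>0$ such that for all $h>0$ $$\Big|Q_h^p[\phi\cdot s]-\int_{\mathbb{R}^n\setminus\{0\}}\phi(x)s(x)\,dx\Big|\le C\,h^{2p-\kappa+2+\delta}.$$ -/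

import Mathlib

open scoped ContDiff SchwartzMap Topology Asymptotics Matrix

noncomputable section

namespace ModTrap

/-- `ℝⁿ` with the Euclidean norm. -/
abbrev E (n : ℕ) : Type := EuclideanSpace ℝ (Fin n)

/-- The reflection `x ↦ (x₁, …, -x_j, …, x_n)`. -/
def reflect {n : ℕ} (j : Fin n) (x : E n) : E n :=
  WithLp.toLp 2 (Function.update x.ofLp j (-(x j)))

/-- The point `β h` of the grid `h ℤⁿ`. -/
def gridPoint {n : ℕ} (h : ℝ) (β : Fin n → ℤ) : E n :=
  WithLp.toLp 2 (fun j => (β j : ℝ) * h)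

/-- The monomial `x^a = ∏ j, x_j ^ a_j` of a multi-index `a`. -/
def monomial {n : ℕ} (a : Fin n → ℕ) (x : E n) : ℝ := ∏ j, x j ^ a j

/-- Weakly singular kernels that are smooth off the origin and have the dilation property with
exponent `δ - n` and the symmetry property with `κ` odd variables (the first `κ` ones).
The value of `s` at the origin is irrelevant. -/
structure IsKernel (n κ : ℕ) (δ : ℝ) (s : E n → ℝ) : Prop where
  delta_pos : 0 < δ
  delta_lt : δ < n
  kappa_le : κ ≤ n
  weaklySingular : ∃ L : ℝ,
    Filter.Tendsto (fun h : ℝ => ∫ x in {x : E n | h < ‖x‖ ∧ ‖x‖ ≤ 1}, s x) (𝓝[>] 0) (𝓝 L)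
  smooth : ContDiffOn ℝ ∞ s {0}ᶜ
  dilation : ∃ ρ : E n → ℝ, ContDiff ℝ ∞ ρ ∧ ρ ≠ 0 ∧
    ∀ x : E n, x ≠ 0 → s x = ‖x‖ ^ (δ - (n : ℝ)) * ρ (‖x‖⁻¹ • x)
  symmetry : ∀ (j : Fin n) (x : E n), x ≠ 0 →
    s x = if (j : ℕ) < κ then -s (reflect j x) else s (reflect j x)

/-- The punctured-hole trapezoidal rule `T_h⁰[f] = hⁿ ∑_{β ∈ ℤⁿ \ {0}} f(β h)`. -/
def puncturedTrapezoidal {n : ℕ} (h : ℝ) (f : E n → ℝ) : ℝ :=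
  h ^ n * ∑' β : {β : Fin n → ℤ // β ≠ 0}, f (gridPoint h β.1)

/-- The product `∏_{1 ≤ j ≤ κ} β_j` of the first `κ` entries. -/
def oddProd {n : ℕ} (κ : ℕ) (β : Fin n → ℤ) : ℤ :=
  ∏ j ∈ Finset.univ.filter (fun j : Fin n => (j : ℕ) < κ), β j

/-- The correction grid `{β ∈ ℤⁿ : |β|₁ ≤ p, ∏_{1 ≤ j ≤ κ} β_j ≠ 0}`. -/
def gridM (n κ p : ℕ) : Finset (Fin n → ℤ) :=
  (Fintype.piFinset fun _ : Fin n => Finset.Icc (-(p : ℤ)) (p : ℤ)).filter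
    (fun β => ∑ j, |β j| ≤ (p : ℤ) ∧ oddProd κ β ≠ 0)

theorem mem_gridM {n κ p : ℕ} {β : Fin n → ℤ} :
    β ∈ gridM n κ p ↔ ∑ j, |β j| ≤ (p : ℤ) ∧ oddProd κ β ≠ 0 := by
  unfold gridM
  rw [Finset.mem_filter, Fintype.mem_piFinset]
  refine ⟨fun hb => hb.2, fun hb => ⟨fun j => ?_, hb⟩⟩
  have hj : |β j| ≤ ∑ i, |β i| :=
    Finset.single_le_sum (f := fun i => |β i|) (fun i _ => abs_nonneg (β i)) (Finset.mem_univ j)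
  exact Finset.mem_Icc.2 (abs_le.1 (hj.trans hb.1))

/-- The part `I(n, p)` of the correction grid with nonnegative entries. -/
def gridI (n κ p : ℕ) : Finset (Fin n → ℤ) :=
  (gridM n κ p).filter (fun β => ∀ j, 0 ≤ β j)

/-- The set of all distinct sign changes `((-1)^{k₁} β₁, …, (-1)^{k_n} β_n)` of `β`. -/
def signOrbit {n : ℕ} (β : Fin n → ℤ) : Finset (Fin n → ℤ) :=
  Finset.univ.image (fun (k : Fin n → Fin 2) (j : Fin n) => (-1) ^ (k j : ℕ) * β j)

/-- The multi-index `2ξ - ∑_{j ≤ κ} e_j`; its entries are nonnegative for `ξ ∈ I(n, p)`, so that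
`Int.toNat` only changes the type. -/
def expo {n : ℕ} (κ : ℕ) (ξ : Fin n → ℤ) (j : Fin n) : ℕ :=
  (2 * ξ j - if (j : ℕ) < κ then 1 else 0).toNat

/-- `g · s · x^{2ξ - ∑_{j ≤ κ} e_j}`. -/
def testIntegrand {n : ℕ} (κ : ℕ) (g s : E n → ℝ) (ξ : Fin n → ℤ) (x : E n) : ℝ :=
  g x * s x * monomial (expo κ ξ) x

/-- The coefficient matrix `K`, with rows and columns indexed by `I(n, p)`. -/
def matK (n κ p : ℕ) : Matrix (gridI n κ p) (gridI n κ p) ℝ :=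
  Matrix.of fun ξ η => ∑ β ∈ signOrbit η.1,
    (Int.sign (oddProd κ β) : ℝ) * ∏ j, (β j : ℝ) ^ expo κ ξ.1 j

/-- The diagonal matrix `G(h)` with the entries `g(η h)`, `η ∈ I(n, p)`. -/
def matG (n κ p : ℕ) (g : E n → ℝ) (h : ℝ) : Matrix (gridI n κ p) (gridI n κ p) ℝ :=
  Matrix.diagonal fun η => g (gridPoint h η.1)

/-- The right-hand side
`c_ξ(h) = h^{-(2|ξ|₁ - κ + δ)} (∫ g s x^{2ξ-∑e_j} dx - T_h⁰[g s x^{2ξ-∑e_j}])`. -/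
def rhs (n κ p : ℕ) (δ : ℝ) (g s : E n → ℝ) (h : ℝ) (ξ : gridI n κ p) : ℝ :=
  1 / h ^ (2 * (∑ j, |(ξ.1 j : ℝ)|) - (κ : ℝ) + δ) *
    ((∫ x, testIntegrand κ g s ξ.1 x) - puncturedTrapezoidal h (testIntegrand κ g s ξ.1))

/-- `w` solves the linear system `K G(h) w = c(h)` of the correction weights at mesh size `h`. -/
def SolvesSystem (n κ p : ℕ) (δ : ℝ) (g s : E n → ℝ) (h : ℝ)
    (w : EuclideanSpace ℝ (gridI n κ p)) : Prop :=
  (matK n κ p * matG n κ p g h) *ᵥ w.ofLp = rhs n κ p δ g s h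

/-- The correction term
`A_h^p[φ] = h^δ ∑_{η ∈ I(n,p)} w_η ∑_{β ∈ G_η} sgn(∏_{j ≤ κ} β_j) φ(β h)`. -/
def correction (n κ p : ℕ) (δ : ℝ) (w : EuclideanSpace ℝ (gridI n κ p)) (h : ℝ)
    (φ : E n → ℝ) : ℝ :=
  h ^ δ * ∑ η : gridI n κ p, w η * ∑ β ∈ signOrbit η.1,
    (Int.sign (oddProd κ β) : ℝ) * φ (gridPoint h β)

/-- The modified trapezoidal rule `Q_h^p[φ s] = T_h⁰[φ s] + A_h^p[φ]` with weights `w`. -/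
def modifiedTrapezoidal (n κ p : ℕ) (δ : ℝ) (w : EuclideanSpace ℝ (gridI n κ p)) (h : ℝ)
    (φ s : E n → ℝ) : ℝ :=
  puncturedTrapezoidal h (fun x => φ x * s x) + correction n κ p δ w h φ

/-- Radial symmetry: the value depends only on the norm. -/
def IsRadial {n : ℕ} (g : E n → ℝ) : Prop := ∀ x y : E n, ‖x‖ = ‖y‖ → g x = g y

/-- All partial derivatives `∂_{i₁} ⋯ ∂_{i_m} g` of the orders `1 ≤ m ≤ M` vanish at `0`. -/
def PartialsVanish {n : ℕ} (g : E n → ℝ) (M : ℕ) : Prop :=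
  ∀ m : ℕ, 1 ≤ m → m ≤ M → ∀ i : Fin m → Fin n,
    iteratedFDeriv ℝ m g 0 (fun a => EuclideanSpace.single (i a) (1 : ℝ)) = 0

/-- `φ ∈ C_c^N(ℝⁿ)` for some natural number `N > max(2p - κ + 2 + δ, n)`, or `φ ∈ 𝓢(ℝⁿ)`. -/
def IsAdmissible (n κ p : ℕ) (δ : ℝ) (φ : E n → ℝ) : Prop :=
  (∃ N : ℕ, max (2 * (p : ℝ) - κ + 2 + δ) n < N ∧ ContDiff ℝ N φ ∧ HasCompactSupport φ) ∨
    ∃ ψ : 𝓢(E n, ℝ), ⇑ψ = φ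

end ModTrap

end

/-! The engine is a scaled error bound for the punctured rule. Call `f` a symbol of order `a` if its
`j`-th derivatives are bounded by `B‖x‖^(a-j)` off the origin. If `f` is a symbol of order `a > -δ`
that decays fast enough, then `T_h⁰[f s]` differs from `∫ f s` by at most `C * B * h^(a+δ)`, where
the decay constants do not enter (`IsKernel.exists_error_bound`). At mesh size one, a cutoff that is
one near the origin and zero at every other lattice point splits off a piece invisible to the
punctured sum, whose integral is controlled by `B`. The rest is smooth, and Poisson summation turns
its error into a sum over nonzero frequencies, bounded by the `L¹` norm of a high derivative.
Dilation yields the power of `h`.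

Let `M = 2p - κ + 1` and let `P` be the Taylor polynomial of `φ` of degree `M` at the origin. Write
`φ = (φ - g P) + g P`. Because `g - 1` is flat to order `M`, the remainder `φ - g P` vanishes to
order `M` and is a symbol of order `M + 1`. Both the punctured rule and the correction term treat it
with an error `h^(M+1+δ)`, whatever the weights are (`isAccurate_windowed_remainder`).

There remain the windowed monomials `g x^k` with `|k|₁ ≤ M` (`isAccurate_monomial`). If the parity
of `k` differs from that of `s` in some coordinate, the integral, the punctured sum and the
correction all vanish by reflection. Otherwise `k` is one of the exponents of the linear system, and
the error is `h^(|k|₁+δ)` times a component of `K G(h) ω̄ - c(h)`. With `K ω̄ = c̄`, where `c̄` is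
the limit of `c(h)`, this is `K (G(h) - 1) ω̄ - (c(h) - c̄)`, of order `h^(M+1)` again.

That `c(h)` has a limit with this rate follows from the same error bound
(`IsKernel.exists_rhs_limit`). By homogeneity, `c(h)` is the error at mesh size one for the window
`g(h ·)`, and `g(h ·) - g(h' ·)` is a symbol of order `M + 1` with constant proportional to `h^(M+1)
+ h'^(M+1)`, which gives a Cauchy estimate.

Finally `K` is invertible (`isUnit_matK`). Sign symmetry reduces it, up to nonzero column factors,
to the values of the monomials `η^(2ξ)`, and tensor products of Newton polynomials in the squares
are triangular on the index set. -/

/-! ## Poisson summation over the integer lattice -/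

noncomputable section

namespace ModTrap
open MeasureTheory Set Filter
open scoped FourierTransform

variable {n : ℕ}

/-- The half-open unit cube with lower corner `β`. -/
def unitCube (β : Fin n → ℤ) : Set (Fin n → ℝ) :=
  {x | ∀ i, x i ∈ Ioc (β i : ℝ) (β i + 1)}

/-- The embedding of the integer lattice into `ℝⁿ`. -/
def latticePoint (β : Fin n → ℤ) : Fin n → ℝ := fun i => (β i : ℝ)

theorem measurableSet_unitCube (β : Fin n → ℤ) : MeasurableSet (unitCube β) := by
  have : unitCube β = Set.pi univ fun i => Ioc (β i : ℝ) (β i + 1) := by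
    ext x; simp [unitCube]
  rw [this]
  exact MeasurableSet.univ_pi fun i => measurableSet_Ioc

theorem iUnion_unitCube : ⋃ β : Fin n → ℤ, unitCube β = univ := by
  -- The cubes are open below and closed above, so the lower corner is the ceiling minus one rather
  -- than the floor.
  refine eq_univ_of_forall fun x => mem_iUnion.2 ⟨fun i => ⌈x i⌉ - 1, fun i => ?_⟩
  have h1 := Int.ceil_lt_add_one (x i)
  have h2 := Int.le_ceil (x i)
  constructor <;> push_cast <;> linarith

theorem pairwise_disjoint_unitCube :
    Pairwise (Function.onFun Disjoint (unitCube (n := n))) := by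
  intro β γ hne
  refine Set.disjoint_left.2 fun x hx hy => hne (funext fun i => ?_)
  have h1 := hx i
  have h2 := hy i
  have h3 : (β i : ℝ) < γ i + 1 := h1.1.trans_le h2.2
  have h4 : (γ i : ℝ) < β i + 1 := h2.1.trans_le h1.2
  norm_cast at h3 h4
  omega

theorem unitCube_preimage (β : Fin n → ℤ) :
    (fun x => x + latticePoint β) ⁻¹' unitCube β = unitCube (0 : Fin n → ℤ) := by
  ext x
  simp only [unitCube, latticePoint, mem_preimage, mem_ofPred_eq, Pi.add_apply, Pi.zero_apply,
    Int.cast_zero, mem_Ioc, zero_add]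
  refine forall_congr' fun i => and_congr ?_ ?_ <;> constructor <;> intro h <;> linarith

theorem volume_unitCube_lt_top (β : Fin n → ℤ) : volume (unitCube β) < ⊤ := by
  have : unitCube β ⊆ Icc (latticePoint β) (latticePoint β + 1) := fun x hx =>
    ⟨fun i => (hx i).1.le, fun i => (hx i).2⟩
  exact (measure_mono this).trans_lt isCompact_Icc.measure_lt_top

theorem volume_real_unitCube (β : Fin n → ℤ) : volume.real (unitCube β) = 1 := by
  have : unitCube β = Set.pi univ fun i => Ioc (β i : ℝ) (β i + 1) := by
    ext x; simp [unitCube]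
  rw [this, Measure.real, Real.volume_pi_Ioc]
  simp

section Cubes
variable {G : Type*} [NormedAddCommGroup G] [NormedSpace ℝ G]

theorem hasSum_setIntegral_unitCube {f : (Fin n → ℝ) → G} (hf : Integrable f) :
    HasSum (fun β : Fin n → ℤ => ∫ x in unitCube β, f x) (∫ x, f x) := by
  have := hasSum_integral_iUnion (μ := volume) (f := f) (fun β => measurableSet_unitCube β)
    pairwise_disjoint_unitCube hf.integrableOn
  rwa [iUnion_unitCube, setIntegral_univ] at this

theorem setIntegral_unitCube_eq (f : (Fin n → ℝ) → G) (β : Fin n → ℤ) :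
    ∫ x in unitCube β, f x = ∫ x in unitCube (0 : Fin n → ℤ), f (x + latticePoint β) := by
  rw [← unitCube_preimage β]
  exact ((measurePreserving_add_right volume (latticePoint β)).setIntegral_preimage_emb
    (MeasurableEquiv.addRight _).measurableEmbedding f (unitCube β)).symm

theorem hasSum_integral_translates {f : (Fin n → ℝ) → G} (hf : Integrable f) :
    HasSum (fun β : Fin n → ℤ => ∫ x in unitCube (0 : Fin n → ℤ), f (x + latticePoint β))
      (∫ x, f x) := by
  have h := hasSum_setIntegral_unitCube hf
  rwa [funext (setIntegral_unitCube_eq f)] at h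

end Cubes

theorem norm_sub_latticePoint_le {β : Fin n → ℤ} {x : Fin n → ℝ} (hx : x ∈ unitCube β) :
    ‖x - latticePoint β‖ ≤ 1 := by
  refine (pi_norm_le_iff_of_nonneg zero_le_one).2 fun i => ?_
  have := hx i
  rw [Real.norm_eq_abs, abs_le, Pi.sub_apply, latticePoint]
  constructor <;> linarith [this.1, this.2]

/-- Peetre's inequality for negative powers of `1 + ‖x‖`. -/
theorem one_add_norm_rpow_neg_le {V : Type*} [NormedAddCommGroup V] {r : ℝ} (hr : 0 ≤ r)
    (x y : V) :
    (1 + ‖x‖) ^ (-r) ≤ (1 + ‖y - x‖) ^ r * (1 + ‖y‖) ^ (-r) := by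
  have hx : 0 < 1 + ‖x‖ := by positivity
  have hy : 0 < 1 + ‖y‖ := by positivity
  have hyx : 0 < 1 + ‖y - x‖ := by positivity
  have key : 1 + ‖y‖ ≤ (1 + ‖y - x‖) * (1 + ‖x‖) := by
    have : ‖y‖ ≤ ‖y - x‖ + ‖x‖ := by simpa using norm_add_le (y - x) x
    nlinarith [norm_nonneg (y - x), norm_nonneg x]
  rw [Real.rpow_neg hx.le, Real.rpow_neg hy.le, ← div_eq_mul_inv, le_div_iff₀ (by positivity),
    inv_mul_le_iff₀ (by positivity), ← Real.mul_rpow hx.le hyx.le]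
  exact Real.rpow_le_rpow hy.le (by linarith [mul_comm (1 + ‖x‖) (1 + ‖y - x‖)]) hr

/-- Comparison with the integral of the same weight: within a unit cube the argument moves by at
most one, so by Peetre's inequality the weight changes by a factor of at most `2 ^ r`. -/
theorem summable_one_add_norm_latticePoint {r : ℝ} (hr : (n : ℝ) < r) :
    Summable fun β : Fin n → ℤ => (1 + ‖latticePoint β‖) ^ (-r) := by
  have hr0 : 0 ≤ r := (Nat.cast_nonneg n).trans hr.le
  have hint : Integrable (fun x : Fin n → ℝ => (1 + ‖x‖) ^ (-r)) :=
    integrable_one_add_norm (by simpa using hr)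
  refine Summable.of_nonneg_of_le (fun β => by positivity) (fun β => ?_)
    ((hasSum_setIntegral_unitCube hint).summable.mul_left ((2 : ℝ) ^ r))
  calc (1 + ‖latticePoint β‖) ^ (-r)
      = ∫ x in unitCube β, (1 + ‖latticePoint β‖) ^ (-r) := by
        rw [setIntegral_const, volume_real_unitCube, one_smul]
    _ ≤ ∫ x in unitCube β, 2 ^ r * (1 + ‖x‖) ^ (-r) := by
        refine setIntegral_mono_on (integrableOn_const (volume_unitCube_lt_top β).ne)
          (hint.integrableOn.const_mul _) (measurableSet_unitCube β) fun x hx => ?_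
        refine (one_add_norm_rpow_neg_le hr0 (latticePoint β) x).trans ?_
        gcongr
        linarith [norm_sub_latticePoint_le hx]
    _ = 2 ^ r * ∫ x in unitCube β, (1 + ‖x‖) ^ (-r) := integral_const_mul _ _

/-- The periodization of `f` over the integer lattice. -/
def periodization (f : (Fin n → ℝ) → ℂ) (x : Fin n → ℝ) : ℂ :=
  ∑' β : Fin n → ℤ, f (x + latticePoint β)

section Periodization

variable {f : (Fin n → ℝ) → ℂ} {C r : ℝ}

/-- Peetre's inequality makes the decay of the translates uniform for `x` in a ball. This is the
majorant for locally uniform convergence of the periodization. -/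
theorem norm_translate_le (hC : 0 ≤ C) (hr : 0 ≤ r) (hf : ∀ x, ‖f x‖ ≤ C * (1 + ‖x‖) ^ (-r))
    {R : ℝ} {x : Fin n → ℝ} (hx : ‖x‖ ≤ R) (β : Fin n → ℤ) :
    ‖f (x + latticePoint β)‖ ≤ C * (1 + R) ^ r * (1 + ‖latticePoint β‖) ^ (-r) := by
  refine (hf _).trans ?_
  rw [mul_assoc]
  refine mul_le_mul_of_nonneg_left ((one_add_norm_rpow_neg_le hr _ (latticePoint β)).trans ?_) hC
  have : ‖latticePoint β - (x + latticePoint β)‖ ≤ R := by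
    rw [← norm_neg]; simpa using hx
  gcongr

theorem continuous_periodization (hr : (n : ℝ) < r) (hcont : Continuous f)
    (hf : ∀ x, ‖f x‖ ≤ C * (1 + ‖x‖) ^ (-r)) : Continuous (periodization f) := by
  have hC : 0 ≤ C := by simpa using (norm_nonneg _).trans (hf 0)
  have hr0 : 0 ≤ r := (Nat.cast_nonneg n).trans hr.le
  rw [continuous_iff_continuousAt]
  intro x₀
  have : ContinuousOn (periodization f) (Metric.ball 0 (‖x₀‖ + 1)) := by
    refine continuousOn_tsum (u := fun β => C * (1 + (‖x₀‖ + 1)) ^ r *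
      (1 + ‖latticePoint β‖) ^ (-r)) (fun β => ?_)
      ((summable_one_add_norm_latticePoint hr).mul_left _) fun β x hx => ?_
    · exact (hcont.comp (continuous_id.add continuous_const)).continuousOn
    · exact norm_translate_le hC hr0 hf (by simpa using (mem_ball_zero_iff.1 hx).le) β
  exact this.continuousAt (Metric.isOpen_ball.mem_nhds (by simp))

theorem periodization_add (x : Fin n → ℝ) (γ : Fin n → ℤ) :
    periodization f (x + latticePoint γ) = periodization f x := by
  unfold periodization
  rw [← (Equiv.addLeft γ).tsum_eq (fun β => f (x + latticePoint β))]
  refine tsum_congr fun β => ?_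
  congr 1
  ext i
  simp [latticePoint, add_assoc]

/-- The projection of `ℝⁿ` onto the torus. -/
def toTorus (x : Fin n → ℝ) : UnitAddTorus (Fin n) := fun i => (x i : UnitAddCircle)

theorem isQuotientMap_toTorus : IsOpenQuotientMap (toTorus (n := n)) := by
  exact IsOpenQuotientMap.piMap (f := fun (_ : Fin n) (x : ℝ) => (x : UnitAddCircle))
    fun _ => QuotientAddGroup.isOpenQuotientMap_mk

/-- Two lifts of a point of the torus differ by a lattice vector, so the periodization descends.
Continuity descends because the projection is a quotient map. -/
theorem exists_torus_lift (hr : (n : ℝ) < r) (hcont : Continuous f)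
    (hf : ∀ x, ‖f x‖ ≤ C * (1 + ‖x‖) ^ (-r)) :
    ∃ A : C(UnitAddTorus (Fin n), ℂ), ∀ x, A (toTorus x) = periodization f x := by
  have hq := isQuotientMap_toTorus (n := n)
  let A : UnitAddTorus (Fin n) → ℂ := fun t => periodization f (Function.surjInv hq.surjective t)
  have hA : ∀ x, A (toTorus x) = periodization f x := by
    intro x
    have h := Function.surjInv_eq hq.surjective (toTorus x)
    have h' : ∀ i, ∃ k : ℤ, x i - Function.surjInv hq.surjective (toTorus x) i = k := by
      intro i
      have hi := congr_fun h i
      simp only [toTorus] at hi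
      obtain ⟨k, hk⟩ := (QuotientAddGroup.eq_iff_sub_mem.1 hi.symm)
      exact ⟨k, by simpa using hk.symm⟩
    choose γ hγ using h'
    have : x = Function.surjInv hq.surjective (toTorus x) + latticePoint γ := by
      ext i; simp [latticePoint, ← hγ]
    conv_rhs => rw [this]
    rw [periodization_add]
  refine ⟨⟨A, hq.isQuotientMap.continuous_iff.2 ?_⟩, hA⟩
  have : A ∘ toTorus = periodization f := funext hA
  rw [this]
  exact continuous_periodization hr hcont hf

end Periodization

theorem mFourier_toTorus (k : Fin n → ℤ) (x : Fin n → ℝ) :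
    UnitAddTorus.mFourier k (toTorus x) =
      Complex.exp (2 * Real.pi * Complex.I * ((∑ i, k i * x i : ℝ) : ℂ)) := by
  simp only [UnitAddTorus.mFourier, ContinuousMap.coe_mk, toTorus, fourier_coe_apply]
  rw [← Complex.exp_sum]
  congr 1
  push_cast
  rw [Finset.mul_sum]
  refine Finset.sum_congr rfl fun i _ => ?_
  ring

theorem mFourier_toTorus_add (k β : Fin n → ℤ) (x : Fin n → ℝ) :
    UnitAddTorus.mFourier k (toTorus (x + latticePoint β)) =
      UnitAddTorus.mFourier k (toTorus x) := by
  congr 1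
  ext i
  simp [toTorus, latticePoint]

theorem norm_mFourier_apply (k : Fin n → ℤ) (t : UnitAddTorus (Fin n)) :
    ‖UnitAddTorus.mFourier k t‖ = 1 := by
  rw [UnitAddTorus.mFourier, ContinuousMap.coe_mk, norm_prod]
  exact Finset.prod_eq_one fun i _ => Circle.norm_coe _

theorem integrable_of_decay {V : Type*} [NormedAddCommGroup V] [NormedSpace ℝ V]
    [FiniteDimensional ℝ V] [MeasurableSpace V] [BorelSpace V] (μ : Measure V)
    [μ.IsAddHaarMeasure] {G : Type*} [NormedAddCommGroup G] {f : V → G} {C r : ℝ}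
    (hr : (Module.finrank ℝ V : ℝ) < r) (hcont : Continuous f)
    (hf : ∀ x, ‖f x‖ ≤ C * (1 + ‖x‖) ^ (-r)) : Integrable f μ :=
  ((integrable_one_add_norm hr).const_mul C).mono' hcont.aestronglyMeasurable
    (Eventually.of_forall hf)

/-- Unfolding: the character is invariant under lattice translations, so integrating it against the
periodization over one cube amounts to integrating it against `f` over all cubes. Absolute
integrability justifies exchanging sum and integral. -/
theorem mFourierCoeff_lift {f : (Fin n → ℝ) → ℂ} {C r : ℝ} (hr : (n : ℝ) < r)
    (hcont : Continuous f) (hf : ∀ x, ‖f x‖ ≤ C * (1 + ‖x‖) ^ (-r))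
    {A : C(UnitAddTorus (Fin n), ℂ)} (hA : ∀ x, A (toTorus x) = periodization f x)
    (k : Fin n → ℤ) :
    UnitAddTorus.mFourierCoeff A k =
      ∫ x : Fin n → ℝ, UnitAddTorus.mFourier (-k) (toTorus x) * f x := by
  have hfi : Integrable f := integrable_of_decay volume (by simpa using hr) hcont hf
  set e : (Fin n → ℝ) → ℂ := fun x => UnitAddTorus.mFourier (-k) (toTorus x) with he
  have hec : Continuous e :=
    (UnitAddTorus.mFourier (-k)).continuous.comp isQuotientMap_toTorus.continuous
  have hen : ∀ x, ‖e x‖ = 1 := fun x => norm_mFourier_apply _ _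
  have hgi : Integrable (fun x => e x * f x) :=
    hfi.mono (hec.mul hcont).aestronglyMeasurable
      (Eventually.of_forall fun x => by simp [hen])
  have hsum := hasSum_integral_translates hgi
  have hsumn := (hasSum_integral_translates hgi.norm).summable
  have hperiod : ∀ x β, e (x + latticePoint β) * f (x + latticePoint β) =
      e x * f (x + latticePoint β) := fun x β => by
    simp only [he, mFourier_toTorus_add]
  simp only [hperiod] at hsum hsumn
  rw [UnitAddTorus.mFourierCoeff_eq_integral A k (fun _ => 0)]
  have hcube : {x : Fin n → ℝ | ∀ i, x i ∈ Ioc (0 : ℝ) (0 + 1)} = unitCube (0 : Fin n → ℤ) := by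
    ext x; simp [unitCube]
  rw [hcube]
  have hint : ∀ β : Fin n → ℤ, Integrable (fun x => e x * f (x + latticePoint β))
      (volume.restrict (unitCube (0 : Fin n → ℤ))) := fun β => by
    have := (hgi.comp_add_right (latticePoint β)).integrableOn (s := unitCube (0 : Fin n → ℤ))
    simp only [hperiod] at this
    exact this
  have h2 := hasSum_integral_of_summable_integral_norm hint hsumn
  rw [hsum.unique h2]
  refine integral_congr_ae (Eventually.of_forall fun x => ?_)
  change e x • A (toTorus x) = _
  rw [hA, periodization, smul_eq_mul]
  exact tsum_mul_left.symm

/-- **Poisson summation** over the integer lattice of `ℝⁿ`. -/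
theorem tsum_gridPoint_eq_tsum_fourier {F : E n → ℂ} {C r : ℝ} (hr : (n : ℝ) < r)
    (hcont : Continuous F) (hF : ∀ x, ‖F x‖ ≤ C * (1 + ‖x‖) ^ (-r))
    (hsum : Summable fun k : Fin n → ℤ => 𝓕 F (gridPoint 1 k)) :
    ∑' β : Fin n → ℤ, F (gridPoint 1 β) = ∑' k : Fin n → ℤ, 𝓕 F (gridPoint 1 k) := by
  set f : (Fin n → ℝ) → ℂ := fun x => F (WithLp.toLp 2 x) with hfdef
  have hC : 0 ≤ C := by simpa using (norm_nonneg _).trans (hF 0)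
  have hr0 : 0 ≤ r := (Nat.cast_nonneg n).trans hr.le
  have hfc : Continuous f := hcont.comp (PiLp.continuous_toLp 2 _)
  have hfb : ∀ x, ‖f x‖ ≤ C * (1 + ‖x‖) ^ (-r) := fun x => by
    refine (hF _).trans (mul_le_mul_of_nonneg_left ?_ hC)
    -- The torus argument uses the sup norm, which the Euclidean norm dominates; hence the Euclidean
    -- decay of `F` implies decay in the sup norm.
    have hx : ‖x‖ ≤ ‖(WithLp.toLp 2 x : E n)‖ :=
      (pi_norm_le_iff_of_nonneg (norm_nonneg _)).2 fun i =>
        PiLp.norm_apply_le (WithLp.toLp 2 x : E n) i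
    exact Real.rpow_le_rpow_of_nonpos (by positivity) (by linarith) (by linarith)
  obtain ⟨A, hA⟩ := exists_torus_lift hr hfc hfb
  have hcoef : ∀ k, UnitAddTorus.mFourierCoeff A k = 𝓕 F (gridPoint 1 k) := fun k => by
    rw [mFourierCoeff_lift hr hfc hfb hA k, Real.fourier_eq',
      ← (PiLp.volume_preserving_toLp (Fin n)).integral_comp
        (MeasurableEquiv.toLp 2 (Fin n → ℝ)).measurableEmbedding]
    refine integral_congr_ae (Eventually.of_forall fun x => ?_)
    simp only [hfdef, smul_eq_mul, mFourier_toTorus]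
    congr 2
    simp only [gridPoint, PiLp.inner_apply, RCLike.inner_apply, conj_trivial, mul_one,
      Pi.neg_apply, Int.cast_neg, neg_mul, Finset.sum_neg_distrib]
    push_cast
    ring
  have hs : Summable (UnitAddTorus.mFourierCoeff A) := by
    simpa only [funext hcoef] using hsum
  -- The formula is the absolutely convergent Fourier series of the periodization, evaluated at the
  -- origin, where all characters equal one.
  have h := UnitAddTorus.hasSum_mFourier_series_apply_of_summable hs (toTorus 0)
  have h0 : ∀ k : Fin n → ℤ, UnitAddTorus.mFourier k (toTorus 0) = 1 := fun k => by
    rw [mFourier_toTorus]; simp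
  simp only [h0, hcoef, smul_eq_mul, mul_one, hA] at h
  rw [h.tsum_eq, periodization]
  refine tsum_congr fun β => ?_
  simp only [hfdef, gridPoint, mul_one, zero_add]
  rfl

end ModTrap
end

/-! ## The trapezoidal error of smooth functions -/

noncomputable section

namespace ModTrap
open MeasureTheory Set Filter
open scoped FourierTransform

variable {n : ℕ}

/-- The transform of the `m`-th derivative, evaluated on `(w, …, w)`, has modulus `(2π)^m ‖w‖^(2m)
‖𝓕 H w‖`, while its operator norm bounds it by the `L¹` norm times `‖w‖^m`. One factor `‖w‖^m`
cancels, and `(2π)^m ≥ 1` is discarded. -/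
theorem norm_pow_mul_norm_fourier_le {V : Type*} [NormedAddCommGroup V] [InnerProductSpace ℝ V]
    [FiniteDimensional ℝ V] [MeasurableSpace V] [BorelSpace V] {m : ℕ} {H : V → ℂ}
    (hH : ContDiff ℝ m H) (hint : ∀ j ≤ m, Integrable (iteratedFDeriv ℝ j H)) (w : V) :
    ‖w‖ ^ m * ‖𝓕 H w‖ ≤ ∫ x, ‖iteratedFDeriv ℝ m H x‖ := by
  rcases eq_or_ne w 0 with rfl | hw
  · rcases Nat.eq_zero_or_pos m with rfl | hm
    · simp only [pow_zero, one_mul]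
      refine (VectorFourier.norm_fourierIntegral_le_integral_norm _ _ _ _ _).trans (le_of_eq ?_)
      simp only [norm_iteratedFDeriv_zero]
    · rw [norm_zero, zero_pow hm.ne', zero_mul]
      positivity
  have hpos : 0 < ‖w‖ := norm_pos_iff.2 hw
  have key := congr_fun (Real.fourier_iteratedFDeriv (N := (m : ℕ∞)) (n := m)
    (by exact_mod_cast hH) (fun j hj => hint j (by exact_mod_cast hj)) le_rfl) w
  have h1 : ‖𝓕 (iteratedFDeriv ℝ m H) w (fun _ => w)‖ ≤
      (∫ x, ‖iteratedFDeriv ℝ m H x‖) * ‖w‖ ^ m := by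
    refine (ContinuousMultilinearMap.le_opNorm _ _).trans ?_
    rw [Finset.prod_const, Finset.card_univ, Fintype.card_fin]
    gcongr
    exact VectorFourier.norm_fourierIntegral_le_integral_norm _ _ _ _ _
  rw [key, VectorFourier.fourierPowSMulRight_apply] at h1
  simp only [Finset.prod_const, Finset.card_univ, Fintype.card_fin] at h1
  rw [norm_smul, norm_smul, norm_pow, norm_pow] at h1
  have h2 : ‖(-innerSL ℝ) w w‖ = ‖w‖ * ‖w‖ := by
    simp [innerSL_apply_apply, sq]
  have h3 : (1 : ℝ) ≤ ‖-(2 * (Real.pi : ℂ) * Complex.I)‖ ^ m := by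
    refine one_le_pow₀ ?_
    simp only [norm_neg, norm_mul, Complex.norm_I, mul_one, Complex.norm_ofNat,
      Complex.norm_real, Real.norm_eq_abs, abs_of_pos Real.pi_pos]
    linarith [Real.pi_gt_three]
  have h2' : ‖((-innerSL ℝ) w : V →L[ℝ] ℝ) w‖ ^ m = ‖w‖ ^ m * ‖w‖ ^ m := by
    rw [h2, mul_pow]
  rw [h2'] at h1
  have h4 : ‖w‖ ^ m * ‖w‖ ^ m * ‖𝓕 H w‖ ≤ (∫ x, ‖iteratedFDeriv ℝ m H x‖) * ‖w‖ ^ m :=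
    (le_mul_of_one_le_left (by positivity) h3).trans h1
  have h5 : 0 < ‖w‖ ^ m := by positivity
  nlinarith [le_of_mul_le_mul_right (a := ‖w‖ ^ m) (b := ‖w‖ ^ m * ‖𝓕 H w‖)
    (c := ∫ x, ‖iteratedFDeriv ℝ m H x‖) (by linarith) h5]

theorem norm_latticePoint_le_norm_gridPoint (β : Fin n → ℤ) :
    ‖latticePoint β‖ ≤ ‖(gridPoint 1 β : E n)‖ :=
  (pi_norm_le_iff_of_nonneg (norm_nonneg _)).2 fun i => by
    simpa [gridPoint, latticePoint] using PiLp.norm_apply_le (gridPoint 1 β : E n) i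

theorem one_le_norm_latticePoint {β : Fin n → ℤ} (hβ : β ≠ 0) : 1 ≤ ‖latticePoint β‖ := by
  obtain ⟨i, hi⟩ := Function.ne_iff.1 hβ
  refine le_trans ?_ (norm_le_pi_norm (latticePoint β) i)
  rw [latticePoint, Real.norm_eq_abs]
  exact_mod_cast Int.one_le_abs hi

theorem one_le_norm_gridPoint {β : Fin n → ℤ} (hβ : β ≠ 0) : 1 ≤ ‖(gridPoint 1 β : E n)‖ :=
  (one_le_norm_latticePoint hβ).trans (norm_latticePoint_le_norm_gridPoint β)

/-- By Poisson summation the difference is the sum of the Fourier transform over nonzero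
frequencies, where it decays like `‖k‖^(-m)` with `m > n`. The decay data `B` and `r` only justify
the manipulations; the constant depends on neither. -/
theorem exists_forall_abs_tsum_sub_integral_le {m : ℕ} (hm : n < m) :
    ∃ C : ℝ, 0 ≤ C ∧ ∀ F : E n → ℝ, ContDiff ℝ m F →
      (∃ B r : ℝ, (n : ℝ) < r ∧ ∀ j ≤ m, ∀ x, ‖iteratedFDeriv ℝ j F x‖ ≤ B * (1 + ‖x‖) ^ (-r)) →
      |∑' β : Fin n → ℤ, F (gridPoint 1 β) - ∫ x, F x| ≤
        C * ∫ x, ‖iteratedFDeriv ℝ m F x‖ := by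
  have hmr : (n : ℝ) < (m : ℝ) := by exact_mod_cast hm
  have hsl := summable_one_add_norm_latticePoint (n := n) hmr
  refine ⟨2 ^ m * ∑' β : Fin n → ℤ, (1 + ‖latticePoint β‖) ^ (-(m : ℝ)), by positivity, ?_⟩
  rintro F hF ⟨B, r, hr, hb⟩
  set H : E n → ℂ := fun x => (F x : ℂ) with hH
  have hHF : H = Complex.ofRealLI ∘ F := rfl
  have hHsm : ContDiff ℝ m H := Complex.ofRealCLM.contDiff.comp hF
  have hnorm : ∀ j ≤ m, ∀ x, ‖iteratedFDeriv ℝ j H x‖ = ‖iteratedFDeriv ℝ j F x‖ :=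
    fun j hj x => by
      rw [hHF]
      exact Complex.ofRealLI.norm_iteratedFDeriv_comp_left hF.contDiffAt (by exact_mod_cast hj)
  have hfin : (Module.finrank ℝ (E n) : ℝ) < r := by simpa using hr
  have hint : ∀ j ≤ m, Integrable (iteratedFDeriv ℝ j H) := fun j hj =>
    integrable_of_decay volume hfin (hHsm.continuous_iteratedFDeriv (by exact_mod_cast hj))
      fun x => (hnorm j hj x).trans_le (hb j hj x)
  set I : ℝ := ∫ x, ‖iteratedFDeriv ℝ m F x‖ with hI
  have hIeq : ∫ x, ‖iteratedFDeriv ℝ m H x‖ = I := by simp only [hnorm m le_rfl, hI]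
  have hI0 : 0 ≤ I := by positivity
  have hfour : ∀ k : Fin n → ℤ, k ≠ 0 →
      ‖𝓕 H (gridPoint 1 k)‖ ≤ I * (2 ^ m * (1 + ‖latticePoint k‖) ^ (-(m : ℝ))) := by
    intro k hk
    have h1 := norm_pow_mul_norm_fourier_le hHsm hint (gridPoint 1 k)
    rw [hIeq] at h1
    have h2 : 1 + ‖latticePoint k‖ ≤ 2 * ‖(gridPoint 1 k : E n)‖ := by
      linarith [one_le_norm_gridPoint hk, norm_latticePoint_le_norm_gridPoint k]
    have h3 : (1 + ‖latticePoint k‖) ^ m ≤ 2 ^ m * ‖(gridPoint 1 k : E n)‖ ^ m := by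
      rw [← mul_pow]
      exact pow_le_pow_left₀ (by positivity) h2 m
    rw [Real.rpow_neg (by positivity), Real.rpow_natCast, ← mul_assoc, ← div_eq_mul_inv,
      le_div_iff₀ (by positivity)]
    calc ‖𝓕 H (gridPoint 1 k)‖ * (1 + ‖latticePoint k‖) ^ m
        ≤ ‖𝓕 H (gridPoint 1 k)‖ * (2 ^ m * ‖(gridPoint 1 k : E n)‖ ^ m) := by gcongr
      _ = 2 ^ m * (‖(gridPoint 1 k : E n)‖ ^ m * ‖𝓕 H (gridPoint 1 k)‖) := by ring
      _ ≤ 2 ^ m * I := by gcongr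
      _ = I * 2 ^ m := mul_comm _ _
  have hsummaj : Summable fun k : Fin n → ℤ =>
      I * (2 ^ m * (1 + ‖latticePoint k‖) ^ (-(m : ℝ))) := (hsl.mul_left _).mul_left _
  -- The zero frequency, which is the integral of `F`, is taken out of the dual sum; the remaining
  -- terms are the error.
  set u : (Fin n → ℤ) → ℂ := fun k => if k = 0 then 0 else 𝓕 H (gridPoint 1 k) with hu
  have hule : ∀ k, ‖u k‖ ≤ I * (2 ^ m * (1 + ‖latticePoint k‖) ^ (-(m : ℝ))) := fun k => by
    by_cases hk : k = 0
    · simp only [hu, hk, if_true, norm_zero]; positivity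
    · simpa only [hu, hk, if_false] using hfour k hk
  have husum : Summable u := Summable.of_norm_bounded hsummaj hule
  have hsingle : HasSum (fun k : Fin n → ℤ => if k = 0 then 𝓕 H (gridPoint 1 0) else 0)
      (𝓕 H (gridPoint 1 0)) := hasSum_ite_eq 0 _
  have hdecomp : (fun k => (if k = 0 then 𝓕 H (gridPoint 1 0) else 0) + u k) =
      fun k : Fin n → ℤ => 𝓕 H (gridPoint 1 k) := by
    ext k
    by_cases hk : k = 0
    · simp [hu, hk]
    · simp [hu, hk]
  have htot := hsingle.add husum.hasSum
  rw [hdecomp] at htot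
  have hpoisson := tsum_gridPoint_eq_tsum_fourier (F := H) hr hHsm.continuous
    (fun x => by
      have := hb 0 (Nat.zero_le _) x
      rw [norm_iteratedFDeriv_zero] at this
      simpa [hH] using this) htot.summable
  rw [htot.tsum_eq] at hpoisson
  have hzero : 𝓕 H (gridPoint 1 0) = ((∫ x, F x : ℝ) : ℂ) := by
    have : (gridPoint 1 0 : E n) = 0 := by ext i; simp [gridPoint]
    rw [this, Real.fourier_eq']
    simp only [hH, inner_zero_right, Complex.ofReal_zero, mul_zero, zero_mul, Complex.exp_zero,
      one_smul]
    exact integral_ofReal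
  have hfinal : ((∑' β : Fin n → ℤ, F (gridPoint 1 β) - ∫ x, F x : ℝ) : ℂ) = ∑' k, u k := by
    rw [Complex.ofReal_sub, Complex.ofReal_tsum, ← hzero]
    exact sub_eq_iff_eq_add'.2 hpoisson
  rw [← Real.norm_eq_abs, ← Complex.norm_real, hfinal]
  refine (tsum_of_norm_bounded hsummaj.hasSum hule).trans (le_of_eq ?_)
  rw [tsum_mul_left, tsum_mul_left]
  ring

end ModTrap
end

/-! ## Symbols: functions bounded like powers of the norm -/

noncomputable section

namespace ModTrap
open MeasureTheory Set Filter

section Symbol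

variable {V : Type*} [NormedAddCommGroup V] [NormedSpace ℝ V]

/-- `f` is `C^m` off the origin and its derivatives of the orders `j ≤ m` are bounded by
`B ‖x‖ ^ (a - j)`. -/
structure IsSymbol (m : ℕ) (a B : ℝ) (f : V → ℝ) : Prop where
  contDiffOn : ContDiffOn ℝ m f {0}ᶜ
  bound : ∀ j ≤ m, ∀ x ≠ 0, ‖iteratedFDeriv ℝ j f x‖ ≤ B * ‖x‖ ^ (a - j)

theorem norm_iteratedFDeriv_comp_smul_le (f : V → ℝ) {t : ℝ} (ht : t ≠ 0) (j : ℕ) (x : V) :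
    ‖iteratedFDeriv ℝ j (fun y => f (t • y)) x‖ ≤ |t| ^ j * ‖iteratedFDeriv ℝ j f (t • x)‖ := by
  let g : V ≃L[ℝ] V := ContinuousLinearEquiv.smulLeft (Units.mk0 t ht)
  have hg : ∀ y, g y = t • y := fun y => rfl
  have h : iteratedFDeriv ℝ j (fun y => f (t • y)) x =
      (iteratedFDeriv ℝ j f (t • x)).compContinuousLinearMap fun _ => (g : V →L[ℝ] V) := by
    simp only [← iteratedFDerivWithin_univ]
    have := g.iteratedFDerivWithin_comp_right f uniqueDiffOn_univ (x := x) (mem_univ _) j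
    rw [preimage_univ] at this
    exact this
  rw [h, mul_comm]
  refine (ContinuousMultilinearMap.norm_compContinuousLinearMap_le _ _).trans ?_
  rw [Finset.prod_const, Finset.card_univ, Fintype.card_fin]
  gcongr
  refine ContinuousLinearMap.opNorm_le_bound _ (abs_nonneg t) fun y => ?_
  change ‖t • y‖ ≤ _
  rw [norm_smul, Real.norm_eq_abs]

namespace IsSymbol

variable {m : ℕ} {a a' B B' : ℝ} {f g : V → ℝ}

theorem contDiffAt (hf : IsSymbol m a B f) {x : V} (hx : x ≠ 0) : ContDiffAt ℝ m f x :=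
  hf.contDiffOn.contDiffAt (isOpen_compl_singleton.mem_nhds hx)

theorem norm_le (hf : IsSymbol m a B f) {x : V} (hx : x ≠ 0) : |f x| ≤ B * ‖x‖ ^ a := by
  simpa using hf.bound 0 (Nat.zero_le _) x hx

theorem nonneg [Nontrivial V] (hf : IsSymbol m a B f) : 0 ≤ B := by
  obtain ⟨x, hx⟩ := exists_ne (0 : V)
  have h : 0 < ‖x‖ ^ a := Real.rpow_pos_of_pos (norm_pos_iff.2 hx) a
  exact nonneg_of_mul_nonneg_left ((abs_nonneg _).trans (hf.norm_le hx)) h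

theorem add (hf : IsSymbol m a B f) (hg : IsSymbol m a B' g) :
    IsSymbol m a (B + B') fun x => f x + g x := by
  refine ⟨hf.contDiffOn.add hg.contDiffOn, fun j hj x hx => ?_⟩
  have hjm : (j : ℕ∞ω) ≤ m := by exact_mod_cast hj
  have : iteratedFDeriv ℝ j (fun x => f x + g x) x =
      iteratedFDeriv ℝ j f x + iteratedFDeriv ℝ j g x :=
    iteratedFDeriv_add_apply ((hf.contDiffAt hx).of_le hjm) ((hg.contDiffAt hx).of_le hjm)
  rw [this, add_mul]
  exact (norm_add_le _ _).trans (add_le_add (hf.bound j hj x hx) (hg.bound j hj x hx))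

theorem const_mul (hf : IsSymbol m a B f) (c : ℝ) : IsSymbol m a (|c| * B) fun x => c * f x := by
  refine ⟨contDiffOn_const.mul hf.contDiffOn, fun j hj x hx => ?_⟩
  have hjm : (j : ℕ∞ω) ≤ m := by exact_mod_cast hj
  have : iteratedFDeriv ℝ j (fun x => c * f x) x = c • iteratedFDeriv ℝ j f x :=
    iteratedFDeriv_const_smul_apply (a := c) (f := f) ((hf.contDiffAt hx).of_le hjm)
  rw [this, norm_smul, Real.norm_eq_abs, mul_assoc]
  gcongr
  exact hf.bound j hj x hx

theorem sub (hf : IsSymbol m a B f) (hg : IsSymbol m a B' g) :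
    IsSymbol m a (B + B') fun x => f x - g x := by
  simpa [sub_eq_add_neg] using hf.add (hg.const_mul (-1))

theorem mul [Nontrivial V] (hf : IsSymbol m a B f) (hg : IsSymbol m a' B' g) :
    IsSymbol m (a + a') (2 ^ m * B * B') fun x => f x * g x := by
  have hB := hf.nonneg
  have hB' := hg.nonneg
  refine ⟨hf.contDiffOn.mul hg.contDiffOn, fun j hj x hx => ?_⟩
  have ho : IsOpen ({0}ᶜ : Set V) := isOpen_compl_singleton
  have hxs : x ∈ ({0}ᶜ : Set V) := hx
  have hpos : 0 < ‖x‖ := norm_pos_iff.2 hx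
  have h := norm_iteratedFDerivWithin_mul_le hf.contDiffOn hg.contDiffOn ho.uniqueDiffOn hxs
    (n := j) (by exact_mod_cast hj)
  rw [iteratedFDerivWithin_of_isOpen _ ho hxs] at h
  refine h.trans ?_
  calc _ ≤ ∑ i ∈ Finset.range (j + 1), (j.choose i : ℝ) * (B * B' * ‖x‖ ^ (a + a' - j)) := by
        refine Finset.sum_le_sum fun i hi => ?_
        have hij : i ≤ j := Nat.lt_succ_iff.1 (Finset.mem_range.1 hi)
        rw [iteratedFDerivWithin_of_isOpen _ ho hxs, iteratedFDerivWithin_of_isOpen _ ho hxs,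
          mul_assoc]
        refine mul_le_mul_of_nonneg_left ?_ (Nat.cast_nonneg _)
        calc _ ≤ (B * ‖x‖ ^ (a - i)) * (B' * ‖x‖ ^ (a' - (j - i : ℕ))) :=
              mul_le_mul (hf.bound i (hij.trans hj) x hx)
                (hg.bound (j - i) ((Nat.sub_le _ _).trans hj) x hx) (norm_nonneg _) (by positivity)
          _ = B * B' * (‖x‖ ^ (a - i) * ‖x‖ ^ (a' - (j - i : ℕ))) := by ring
          _ = _ := by
              rw [← Real.rpow_add hpos, Nat.cast_sub hij]
              ring_nf
    _ = 2 ^ j * (B * B' * ‖x‖ ^ (a + a' - j)) := by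
        rw [← Finset.sum_mul]
        congr 1
        exact_mod_cast Nat.sum_range_choose j
    _ ≤ 2 ^ m * (B * B' * ‖x‖ ^ (a + a' - j)) := by
        gcongr
        exact one_le_two
    _ = _ := by ring

/-- The factor `t ^ j` of the chain rule exactly compensates the `-j` in the exponent, so a dilation
multiplies the constant of a symbol by `t ^ a` in every order of differentiation. All powers of the
mesh size in the error bounds come from here. -/
theorem comp_smul (hf : IsSymbol m a B f) {t : ℝ} (ht : 0 < t) :
    IsSymbol m a (B * t ^ a) fun x => f (t • x) := by
  refine ⟨?_, fun j hj x hx => ?_⟩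
  · refine hf.contDiffOn.comp (contDiff_const_smul t).contDiffOn fun x hx => ?_
    exact smul_ne_zero ht.ne' hx
  · refine (norm_iteratedFDeriv_comp_smul_le f ht.ne' j x).trans ?_
    have h := hf.bound j hj (t • x) (smul_ne_zero ht.ne' hx)
    have hpos : 0 < ‖x‖ := norm_pos_iff.2 hx
    rw [norm_smul, Real.norm_eq_abs, abs_of_pos ht, Real.mul_rpow ht.le hpos.le] at h
    rw [abs_of_pos ht]
    calc _ ≤ t ^ j * (B * (t ^ (a - j) * ‖x‖ ^ (a - j))) := by gcongr
      _ = B * (t ^ (j : ℝ) * t ^ (a - j)) * ‖x‖ ^ (a - j) := by rw [Real.rpow_natCast]; ring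
      _ = _ := by rw [← Real.rpow_add ht]; ring_nf

end IsSymbol

/-- A function that is smooth off the origin and homogeneous is a symbol. -/
theorem exists_isSymbol_of_homogeneous [FiniteDimensional ℝ V] (m : ℕ) {d : ℝ} {f : V → ℝ}
    (hf : ContDiffOn ℝ m f {0}ᶜ)
    (hhom : ∀ t : ℝ, 0 < t → ∀ x ≠ 0, f (t • x) = t ^ d * f x) :
    ∃ B, IsSymbol m d B f := by
  have ho : IsOpen ({0}ᶜ : Set V) := isOpen_compl_singleton
  have hsph : Metric.sphere (0 : V) 1 ⊆ {0}ᶜ := fun x hx h0 => by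
    rw [mem_singleton_iff.1 h0] at hx; simp at hx
  have hex : ∀ j : ℕ, ∃ C, j ≤ m → ∀ x ∈ Metric.sphere (0 : V) 1, ‖iteratedFDeriv ℝ j f x‖ ≤ C := by
    intro j
    by_cases hj : j ≤ m
    · have hc := (hf.continuousOn_iteratedFDerivWithin (by exact_mod_cast hj) ho.uniqueDiffOn).congr
        (fun x hx => (iteratedFDerivWithin_of_isOpen j ho hx).symm)
      obtain ⟨C, hC⟩ := (isCompact_sphere (0 : V) 1).exists_bound_of_continuousOn (hc.mono hsph)
      exact ⟨C, fun _ => hC⟩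
    · exact ⟨0, fun h => absurd h hj⟩
  choose C hC using hex
  refine ⟨∑ j ∈ Finset.range (m + 1), |C j|, hf, fun j hj x hx => ?_⟩
  have hpos : 0 < ‖x‖ := norm_pos_iff.2 hx
  have hipos : 0 < ‖x‖⁻¹ := inv_pos.2 hpos
  have hjC : C j ≤ ∑ j ∈ Finset.range (m + 1), |C j| := (le_abs_self _).trans
    (Finset.single_le_sum (f := fun j => |C j|) (fun i _ => abs_nonneg _)
      (Finset.mem_range.2 (Nat.lt_succ_of_le hj)))
  -- With `‖x‖` frozen and `y` varying near `x`, homogeneity moves the derivatives at `x` to the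
  -- unit sphere, where compactness bounds them.
  have hev : f =ᶠ[𝓝 x] fun y => ‖x‖ ^ d • f (‖x‖⁻¹ • y) := by
    filter_upwards [ho.mem_nhds hx] with y hy
    rw [hhom _ hipos y hy, smul_eq_mul, ← mul_assoc, ← Real.mul_rpow hpos.le hipos.le,
      mul_inv_cancel₀ hpos.ne', Real.one_rpow, one_mul]
  have hcd : ContDiffAt ℝ j (fun y => f (‖x‖⁻¹ • y)) x := by
    have h1 : ContDiffAt ℝ j f (‖x‖⁻¹ • x) :=
      (hf.contDiffAt (ho.mem_nhds (smul_ne_zero hipos.ne' hx))).of_le (by exact_mod_cast hj)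
    exact h1.comp x (contDiff_const_smul _).contDiffAt
  have heq : iteratedFDeriv ℝ j f x =
      ‖x‖ ^ d • iteratedFDeriv ℝ j (fun y => f (‖x‖⁻¹ • y)) x := by
    rw [(hev.iteratedFDeriv ℝ j).eq_of_nhds]
    exact iteratedFDeriv_const_smul_apply (a := ‖x‖ ^ d) (f := fun y => f (‖x‖⁻¹ • y)) hcd
  have hmem : ‖x‖⁻¹ • x ∈ Metric.sphere (0 : V) 1 := by
    simp [norm_smul, inv_mul_cancel₀ hpos.ne']
  rw [heq, norm_smul, Real.norm_eq_abs, abs_of_pos (Real.rpow_pos_of_pos hpos d)]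
  calc _ ≤ ‖x‖ ^ d * (‖x‖⁻¹ ^ j * C j) := by
        refine mul_le_mul_of_nonneg_left ?_ (by positivity)
        refine (norm_iteratedFDeriv_comp_smul_le f hipos.ne' j x).trans ?_
        rw [abs_of_pos hipos]
        exact mul_le_mul_of_nonneg_left (hC j hj _ hmem) (by positivity)
    _ = C j * ‖x‖ ^ (d - j) := by
        rw [Real.rpow_sub hpos, Real.rpow_natCast]; ring
    _ ≤ _ := by gcongr

/-- `C^m` functions whose derivatives up to the order `m` decay faster than any power. -/
structure IsRapidlyDecaying (m : ℕ) (f : V → ℝ) : Prop where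
  contDiff : ContDiff ℝ m f
  decay : ∀ k : ℕ, ∀ j ≤ m, ∃ C, ∀ x, ‖x‖ ^ k * ‖iteratedFDeriv ℝ j f x‖ ≤ C

theorem _root_.SchwartzMap.isRapidlyDecaying (m : ℕ) (f : 𝓢(V, ℝ)) : IsRapidlyDecaying m f :=
  ⟨f.smooth m, fun k j _ => (f.decay k j).imp fun _ h => h.2⟩

theorem isRapidlyDecaying_of_hasCompactSupport {m : ℕ} {f : V → ℝ} (hf : ContDiff ℝ m f)
    (hs : HasCompactSupport f) : IsRapidlyDecaying m f := by
  refine ⟨hf, fun k j hj => ?_⟩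
  have hcont : Continuous fun x => ‖x‖ ^ k * ‖iteratedFDeriv ℝ j f x‖ :=
    (continuous_norm.pow k).mul (hf.continuous_iteratedFDeriv (by exact_mod_cast hj)).norm
  have hsup : HasCompactSupport fun x => ‖x‖ ^ k * ‖iteratedFDeriv ℝ j f x‖ :=
    (hs.iteratedFDeriv j).norm.mul_left
  obtain ⟨C, hC⟩ := hcont.bounded_above_of_compact_support hsup
  exact ⟨C, fun x => (le_abs_self _).trans (hC x)⟩

/-- Inside the unit ball bounded derivatives suffice because `a - j ≤ 0`. Outside, decay of an order
`K ≥ m - a` serves all `j ≤ m` at once. -/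
theorem IsRapidlyDecaying.exists_isSymbol {m : ℕ} {f : V → ℝ} (hf : IsRapidlyDecaying m f)
    {a : ℝ} (ha : a ≤ 0) : ∃ B, IsSymbol m a B f := by
  obtain ⟨K, hK⟩ := exists_nat_ge ((m : ℝ) - a)
  have hex : ∀ j : ℕ, ∃ C, j ≤ m → ∀ x,
      ‖iteratedFDeriv ℝ j f x‖ ≤ C ∧ ‖x‖ ^ K * ‖iteratedFDeriv ℝ j f x‖ ≤ C := by
    intro j
    by_cases hj : j ≤ m
    · obtain ⟨C₀, h₀⟩ := hf.decay 0 j hj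
      obtain ⟨C₁, h₁⟩ := hf.decay K j hj
      exact ⟨max C₀ C₁, fun _ x => ⟨by simpa using Or.inl (h₀ x), (h₁ x).trans (le_max_right _ _)⟩⟩
    · exact ⟨0, fun h => absurd h hj⟩
  choose C hC using hex
  refine ⟨∑ j ∈ Finset.range (m + 1), |C j|, hf.contDiff.contDiffOn, fun j hj x hx => ?_⟩
  have hpos : 0 < ‖x‖ := norm_pos_iff.2 hx
  have hjC : C j ≤ ∑ j ∈ Finset.range (m + 1), |C j| := (le_abs_self _).trans
    (Finset.single_le_sum (f := fun j => |C j|) (fun i _ => abs_nonneg _)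
      (Finset.mem_range.2 (Nat.lt_succ_of_le hj)))
  have hj' : (j : ℝ) ≤ m := by exact_mod_cast hj
  have hj0 : (0 : ℝ) ≤ j := Nat.cast_nonneg j
  obtain ⟨h₀, h₁⟩ := hC j hj x
  have hC0 : 0 ≤ C j := (norm_nonneg _).trans h₀
  refine le_trans ?_ (mul_le_mul_of_nonneg_right hjC (by positivity))
  rcases le_total ‖x‖ 1 with hx1 | hx1
  · refine h₀.trans (le_mul_of_one_le_right hC0 ?_)
    exact Real.one_le_rpow_of_pos_of_le_one_of_nonpos hpos hx1 (by linarith)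
  · have h2 : ‖iteratedFDeriv ℝ j f x‖ ≤ C j * ‖x‖ ^ (-(K : ℝ)) := by
      rw [Real.rpow_neg hpos.le, Real.rpow_natCast, ← div_eq_mul_inv, le_div_iff₀ (by positivity)]
      linarith
    refine h2.trans (mul_le_mul_of_nonneg_left ?_ hC0)
    exact Real.rpow_le_rpow_of_exponent_le hx1 (by linarith)

theorem isSymbol_const (m : ℕ) (c : ℝ) : IsSymbol m 0 |c| fun _ : V => c := by
  refine ⟨contDiffOn_const, fun j hj x hx => ?_⟩
  rcases Nat.eq_zero_or_pos j with rfl | hj0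
  · simp
  · rw [iteratedFDeriv_const_of_ne hj0.ne']
    simp only [Pi.zero_apply, norm_zero]
    positivity

/-- A `C^m` function whose derivatives up to the order `M` vanish at the origin is a symbol of
order `M + 1`, provided that it does not grow faster at infinity. -/
theorem exists_isSymbol_of_vanishing [FiniteDimensional ℝ V] {m M : ℕ} {a B : ℝ} {f : V → ℝ}
    (hfs : IsSymbol m a B f) (hf : ContDiff ℝ m f) (ha : a ≤ M + 1) (hM : M + 1 ≤ m)
    (h0 : ∀ j ≤ M, iteratedFDeriv ℝ j f 0 = 0) : ∃ B', IsSymbol m (M + 1) B' f := by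
  have hex : ∀ j : ℕ, ∃ C, j ≤ m → ∀ x ∈ Metric.closedBall (0 : V) 1,
      ‖iteratedFDeriv ℝ j f x‖ ≤ C := by
    intro j
    by_cases hj : j ≤ m
    · obtain ⟨C, hC⟩ := (isCompact_closedBall (0 : V) 1).exists_bound_of_continuousOn
        (hf.continuous_iteratedFDeriv (m := j) (by exact_mod_cast hj)).continuousOn
      exact ⟨C, fun _ => hC⟩
    · exact ⟨0, fun h => absurd h hj⟩
  choose C hC using hex
  set D := ∑ j ∈ Finset.range (m + 1), |C j| with hD
  have hD0 : 0 ≤ D := Finset.sum_nonneg fun j _ => abs_nonneg _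
  have hCD : ∀ j ≤ m, ∀ x, ‖x‖ ≤ 1 → ‖iteratedFDeriv ℝ j f x‖ ≤ D := fun j hj x hx =>
    (hC j hj x (by simpa using hx)).trans ((le_abs_self _).trans
      (Finset.single_le_sum (f := fun j => |C j|) (fun i _ => abs_nonneg _)
        (Finset.mem_range.2 (Nat.lt_succ_of_le hj))))
  -- Downward induction on the order of the derivative: starting from boundedness at order `M + 1`,
  -- the mean value inequality on the ball of radius `‖x‖` gains one power of `‖x‖` at each step,
  -- since the derivative vanishes at the origin.
  have claim : ∀ i j : ℕ, j + i = M + 1 → ∀ x, ‖x‖ ≤ 1 →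
      ‖iteratedFDeriv ℝ j f x‖ ≤ D * ‖x‖ ^ i := by
    intro i
    induction i with
    | zero => intro j hj x hx; simpa using hCD j (by omega) x hx
    | succ i ih =>
      intro j hj x hx
      have hd : ∀ y ∈ Metric.closedBall (0 : V) ‖x‖,
          DifferentiableAt ℝ (iteratedFDeriv ℝ j f) y := fun y _ =>
        (hf.differentiable_iteratedFDeriv (by exact_mod_cast (by omega : j < m))) y
      have hb : ∀ y ∈ Metric.closedBall (0 : V) ‖x‖,
          ‖fderiv ℝ (iteratedFDeriv ℝ j f) y‖ ≤ D * ‖x‖ ^ i := fun y hy => by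
        have hy' : ‖y‖ ≤ ‖x‖ := by simpa using hy
        rw [norm_fderiv_iteratedFDeriv]
        refine (ih (j + 1) (by omega) y (hy'.trans hx)).trans ?_
        gcongr
      have h := (convex_closedBall (0 : V) ‖x‖).norm_image_sub_le_of_norm_fderiv_le hd hb
        (Metric.mem_closedBall_self (norm_nonneg x)) (y := x) (by simp)
      rw [h0 j (by omega), sub_zero, sub_zero] at h
      rwa [pow_succ, ← mul_assoc]
  refine ⟨D + |B|, hfs.contDiffOn, fun j hj x hx => ?_⟩
  have hpos : 0 < ‖x‖ := norm_pos_iff.2 hx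
  rcases le_total ‖x‖ 1 with hx1 | hx1
  · have h1 : ‖iteratedFDeriv ℝ j f x‖ ≤ D * ‖x‖ ^ ((M : ℝ) + 1 - j) := by
      rcases le_total j (M + 1) with hjM | hjM
      · have h := claim (M + 1 - j) j (by omega) x hx1
        rw [← Real.rpow_natCast, Nat.cast_sub hjM] at h
        simpa using h
      · refine (hCD j hj x hx1).trans (le_mul_of_one_le_right hD0 ?_)
        have : ((M + 1 : ℕ) : ℝ) ≤ j := by exact_mod_cast hjM
        push_cast at this
        exact Real.one_le_rpow_of_pos_of_le_one_of_nonpos hpos hx1 (by linarith)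
    refine h1.trans ?_
    gcongr
    linarith [abs_nonneg B]
  · refine (hfs.bound j hj x hx).trans ?_
    have h1 : B * ‖x‖ ^ (a - j) ≤ |B| * ‖x‖ ^ (a - j) := by gcongr; exact le_abs_self B
    refine h1.trans ?_
    refine mul_le_mul (by linarith) (Real.rpow_le_rpow_of_exponent_le hx1 (by linarith))
      (by positivity) (by positivity)

end Symbol

end ModTrap
end

/-! ## The punctured trapezoidal rule for symbols -/

noncomputable section

namespace ModTrap
open MeasureTheory Set Filter

section Cutoff

variable {V : Type*} [NormedAddCommGroup V] [NormedSpace ℝ V]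

theorem IsSymbol.contDiff_of_eq_zero {m : ℕ} {a B : ℝ} {f : V → ℝ} (hf : IsSymbol m a B f)
    {R : ℝ} (hR : 0 < R) (h0 : ∀ x, ‖x‖ < R → f x = 0) : ContDiff ℝ m f := by
  rw [contDiff_iff_contDiffAt]
  intro x
  by_cases hx : x = 0
  · subst hx
    refine contDiffAt_const (c := (0 : ℝ)) |>.congr_of_eventuallyEq ?_
    filter_upwards [Metric.ball_mem_nhds (0 : V) hR] with y hy
    exact h0 y (by simpa using hy)
  · exact hf.contDiffAt hx

/-- A symbol that vanishes near the origin satisfies its bounds with `1 + ‖x‖` in place of `‖x‖`. -/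
theorem IsSymbol.bound_one_add_norm [Nontrivial V] {m : ℕ} {a B : ℝ} {f : V → ℝ}
    (hf : IsSymbol m a B f) (h0 : ∀ x, ‖x‖ < 1 / 4 → f x = 0) {j : ℕ} (hj : j ≤ m) (haj : a ≤ j)
    (x : V) : ‖iteratedFDeriv ℝ j f x‖ ≤ B * 5 ^ ((j : ℝ) - a) * (1 + ‖x‖) ^ (-((j : ℝ) - a)) := by
  have hB := hf.nonneg
  rcases lt_or_ge ‖x‖ (1 / 4) with hx | hx
  · have hev : f =ᶠ[𝓝 x] fun _ => (0 : ℝ) := by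
      filter_upwards [(isOpen_lt continuous_norm continuous_const).mem_nhds hx] with y hy
      exact h0 y hy
    rw [(hev.iteratedFDeriv ℝ j).eq_of_nhds]
    have : iteratedFDeriv ℝ j (fun _ : V => (0 : ℝ)) x = 0 := by
      rw [iteratedFDeriv_fun_zero]; rfl
    rw [this, norm_zero]
    positivity
  · have hpos : 0 < ‖x‖ := by linarith
    refine (hf.bound j hj x (norm_pos_iff.1 hpos)).trans ?_
    rw [mul_assoc]
    refine mul_le_mul_of_nonneg_left ?_ hB
    rw [show a - (j : ℝ) = -((j : ℝ) - a) by ring, Real.rpow_neg hpos.le,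
      Real.rpow_neg (by positivity), ← div_eq_mul_inv, inv_le_iff_one_le_mul₀ (by positivity),
      div_mul_eq_mul_div, one_le_div (by positivity), ← Real.mul_rpow (by norm_num) hpos.le]
    -- Here `1 + ‖x‖ ≤ 5 * ‖x‖`, because `‖x‖ ≥ 1 / 4`; this is the source of the constant `5`.
    exact Real.rpow_le_rpow (by positivity) (by linarith) (by linarith)

end Cutoff

variable {n : ℕ}

theorem IsSymbol.aestronglyMeasurable {m : ℕ} {a B : ℝ} {f : E n → ℝ} (hn : 0 < n)
    (hf : IsSymbol m a B f) : AEStronglyMeasurable f := by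
  have : Nonempty (Fin n) := ⟨⟨0, hn⟩⟩
  rw [← restrict_compl_singleton (μ := (volume : Measure (E n))) 0]
  exact hf.contDiffOn.continuousOn.aestronglyMeasurable (measurableSet_singleton _).compl

theorem summable_gridPoint_of_decay {F : E n → ℝ} {C r : ℝ} (hr : (n : ℝ) < r)
    (hF : ∀ x, |F x| ≤ C * (1 + ‖x‖) ^ (-r)) :
    Summable fun β : Fin n → ℤ => F (gridPoint 1 β) := by
  have hC : 0 ≤ C := by simpa using (abs_nonneg _).trans (hF 0)
  have hr0 : 0 ≤ r := (Nat.cast_nonneg n).trans hr.le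
  refine Summable.of_norm_bounded ((summable_one_add_norm_latticePoint hr).mul_left C) fun β => ?_
  refine (hF _).trans (mul_le_mul_of_nonneg_left ?_ hC)
  exact Real.rpow_le_rpow_of_nonpos (by positivity)
    (by linarith [norm_latticePoint_le_norm_gridPoint β]) (by linarith)

/-- The error of the punctured trapezoidal rule of mesh size one for a symbol of order `b - n`. -/
theorem exists_forall_abs_tsum_punctured_sub_integral_le (hn : 0 < n) {m : ℕ} (hm : n < m) {b : ℝ}
    (hb0 : 0 < b) (hbm : b < m) :
    ∃ C : ℝ, 0 ≤ C ∧ ∀ (f : E n → ℝ) (B B' : ℝ), IsSymbol m (b - n) B f →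
      IsSymbol m (-(n : ℝ) - 1) B' f → Integrable f ∧
      (Summable fun β : {β : Fin n → ℤ // β ≠ 0} => f (gridPoint 1 β.1)) ∧
      |∑' β : {β : Fin n → ℤ // β ≠ 0}, f (gridPoint 1 β.1) - ∫ x, f x| ≤ C * B := by
  have : Nonempty (Fin n) := ⟨⟨0, hn⟩⟩
  have hfr : Module.finrank ℝ (E n) = n := by simp
  obtain ⟨C₀, hC₀, hpoisson⟩ := exists_forall_abs_tsum_sub_integral_le hm
  -- Nonzero lattice points have norm at least one, outside the support of `χ`, and `1 - χ` vanishes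
  -- near the origin. Thus `(1 - χ) f` is smooth, and its full lattice sum is the punctured sum of
  -- `f`.
  let χ : ContDiffBump (0 : E n) := ⟨1 / 4, 1 / 2, by norm_num, by norm_num⟩
  have hχ1 : ∀ x : E n, ‖x‖ < 1 / 4 → χ x = 1 := fun x hx =>
    χ.one_of_mem_closedBall (mem_closedBall_zero_iff.2 hx.le)
  have hχ0 : ∀ x : E n, 1 / 2 ≤ ‖x‖ → χ x = 0 := fun x hx =>
    χ.zero_of_le_dist (by rw [dist_zero_right]; exact hx)
  obtain ⟨B₁, hB₁⟩ := (isRapidlyDecaying_of_hasCompactSupport (m := m) (f := χ)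
    χ.contDiff χ.hasCompactSupport).exists_isSymbol le_rfl
  have hcut := (isSymbol_const (V := E n) m 1).sub hB₁
  set c : ℝ := |1| + B₁ with hc
  have hc0 : 0 ≤ c := hcut.nonneg
  set r : ℝ := (m : ℝ) - (b - n) with hr
  have hrn : (n : ℝ) < r := by rw [hr]; linarith
  set J : ℝ := ∫ x : E n, (1 + ‖x‖) ^ (-r) with hJ
  have hJint : Integrable fun x : E n => (1 + ‖x‖) ^ (-r) :=
    integrable_one_add_norm (by rw [hfr]; exact hrn)
  set J' : ℝ := ∫ x in Metric.ball (0 : E n) 1, ‖x‖ ^ (b - n) with hJ'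
  have hJ'int : IntegrableOn (fun x : E n => ‖x‖ ^ (b - n)) (Metric.ball (0 : E n) 1) := by
    refine integrableOn_ball_of_norm_le_rpow (C := 1) (α := (n : ℝ) - b) (by rw [hfr]; exact hn)
      (by rw [hfr]; linarith) (Eventually.of_forall fun x => ?_) ?_
    · rw [Real.norm_eq_abs, abs_of_nonneg (by positivity), one_mul, neg_sub]
    · exact (measurable_norm.pow_const _).aestronglyMeasurable
  have hJ'0 : 0 ≤ J' := by positivity
  have hJ0 : 0 ≤ J := by positivity
  refine ⟨C₀ * (2 ^ m * c * 5 ^ r * J) + J', by positivity, fun f B B' hfB hfB' => ?_⟩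
  have hB := hfB.nonneg
  set F : E n → ℝ := fun x => (1 - χ x) * f x with hF
  have hF0 : ∀ x : E n, ‖x‖ < 1 / 4 → F x = 0 := fun x hx => by simp [hF, hχ1 x hx]
  have hFf : ∀ x : E n, 1 / 2 ≤ ‖x‖ → F x = f x := fun x hx => by simp [hF, hχ0 x hx]
  have hFB : IsSymbol m (b - n) (2 ^ m * c * B) F := by simpa using hcut.mul hfB
  have hFB' : IsSymbol m (-(n : ℝ) - 1) (2 ^ m * c * B') F := by simpa using hcut.mul hfB'
  have hFc : ContDiff ℝ m F := hFB.contDiff_of_eq_zero (by norm_num) hF0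
  have hB'0 := hFB'.nonneg
  -- This uses the auxiliary order `-n - 1`, with its constant `B'`, solely to obtain integrability,
  -- summability and admissibility for Poisson summation. The quantitative bound below involves only
  -- `B`.
  have hdecay : ∀ j ≤ m, ∀ x, ‖iteratedFDeriv ℝ j F x‖ ≤
      2 ^ m * c * B' * 5 ^ ((m : ℝ) + n + 1) * (1 + ‖x‖) ^ (-((n : ℝ) + 1)) := fun j hj x => by
    have hj' : (j : ℝ) ≤ m := by exact_mod_cast hj
    have hj0 : (0 : ℝ) ≤ j := Nat.cast_nonneg j
    have hn0 : (0 : ℝ) ≤ n := Nat.cast_nonneg n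
    refine (hFB'.bound_one_add_norm hF0 hj (by linarith) x).trans ?_
    refine mul_le_mul (mul_le_mul_of_nonneg_left ?_ hB'0) ?_ (by positivity) (by positivity)
    · exact Real.rpow_le_rpow_of_exponent_le (by norm_num) (by linarith)
    · exact Real.rpow_le_rpow_of_exponent_le (by linarith [norm_nonneg x]) (by linarith)
  have hdecay0 : ∀ x, |F x| ≤
      2 ^ m * c * B' * 5 ^ ((m : ℝ) + n + 1) * (1 + ‖x‖) ^ (-((n : ℝ) + 1)) := fun x => by
    simpa using hdecay 0 (Nat.zero_le _) x
  have hFint : Integrable F :=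
    integrable_of_decay volume (r := (n : ℝ) + 1) (by rw [hfr]; linarith) hFc.continuous hdecay0
  have hχf : ∀ᵐ x : E n, ‖χ x * f x‖ ≤
      (Metric.ball (0 : E n) 1).indicator (fun x => B * ‖x‖ ^ (b - n)) x := by
    have hne : ∀ᵐ x : E n, x ≠ 0 := by simp [ae_iff]
    filter_upwards [hne] with x hx
    rcases lt_or_ge ‖x‖ 1 with h | h
    · rw [indicator_of_mem (by simpa using h), norm_mul, Real.norm_eq_abs, Real.norm_eq_abs,
        abs_of_nonneg χ.nonneg]
      exact (mul_le_of_le_one_left (abs_nonneg _) χ.le_one).trans (hfB.norm_le hx)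
    · rw [hχ0 x (by linarith), indicator_of_notMem (by simpa using h)]
      simp
  have hmaj : Integrable ((Metric.ball (0 : E n) 1).indicator fun x => B * ‖x‖ ^ (b - n)) :=
    IntegrableOn.integrable_indicator (hJ'int.const_mul B) Metric.isOpen_ball.measurableSet
  have hχfint : Integrable fun x => χ x * f x :=
    hmaj.mono' (χ.continuous.aestronglyMeasurable.mul (hfB.aestronglyMeasurable hn)) hχf
  have hsplit : f = fun x => F x + χ x * f x := by ext x; simp only [hF]; ring
  have hfint : Integrable f := by rw [hsplit]; exact hFint.add hχfint
  have hsumF := summable_gridPoint_of_decay (r := (n : ℝ) + 1) (by linarith) hdecay0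
  have hgrid : ∀ β : {β : Fin n → ℤ // β ≠ 0}, F (gridPoint 1 β.1) = f (gridPoint 1 β.1) :=
    fun β => hFf _ (by linarith [one_le_norm_gridPoint β.2])
  have hgrid0 : F (gridPoint 1 0) = 0 := hF0 _ (by
    have : (gridPoint 1 0 : E n) = 0 := by ext i; simp [gridPoint]
    rw [this]; norm_num)
  refine ⟨hfint, ?_, ?_⟩
  · have := hsumF.subtype {β : Fin n → ℤ | β ≠ 0}
    exact this.congr fun β => hgrid β
  · have htsum : ∑' β : {β : Fin n → ℤ // β ≠ 0}, f (gridPoint 1 β.1) =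
        ∑' β : Fin n → ℤ, F (gridPoint 1 β) := by
      simp only [← hgrid]
      refine tsum_subtype_eq_of_support_subset (f := fun β : Fin n → ℤ => F (gridPoint 1 β))
        (s := {β : Fin n → ℤ | β ≠ 0}) fun β hβ h => ?_
      subst h
      exact hβ hgrid0
    have hint : ∫ x, f x = (∫ x, F x) + ∫ x, χ x * f x := by
      conv_lhs => rw [hsplit]
      exact integral_add hFint hχfint
    rw [htsum, hint, ← sub_sub]
    refine (abs_sub _ _).trans ?_
    rw [add_mul]
    refine add_le_add ?_ ?_
    · refine (hpoisson F hFc ⟨_, (n : ℝ) + 1, by linarith, hdecay⟩).trans ?_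
      rw [mul_assoc]
      refine mul_le_mul_of_nonneg_left ?_ hC₀
      -- At the top order `m`, the symbol bound of order `b - n` gives decay with exponent `r = m -
      -- b + n`, which exceeds `n` because `b < m`. The `L¹` norm is therefore controlled by `B`
      -- alone.
      have hbd : ∀ x, ‖iteratedFDeriv ℝ m F x‖ ≤ 2 ^ m * c * B * 5 ^ r * (1 + ‖x‖) ^ (-r) :=
        fun x => hFB.bound_one_add_norm hF0 le_rfl (by linarith) x
      calc _ ≤ ∫ x : E n, 2 ^ m * c * B * 5 ^ r * (1 + ‖x‖) ^ (-r) :=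
            integral_mono_of_nonneg (Eventually.of_forall fun x => norm_nonneg _)
              (hJint.const_mul _) (Eventually.of_forall hbd)
        _ = _ := by rw [integral_const_mul, ← hJ]; ring
    · rw [← Real.norm_eq_abs]
      refine (norm_integral_le_of_norm_le hmaj hχf).trans (le_of_eq ?_)
      rw [integral_indicator Metric.isOpen_ball.measurableSet, integral_const_mul, mul_comm]

theorem smul_gridPoint (h : ℝ) (β : Fin n → ℤ) : h • (gridPoint 1 β : E n) = gridPoint h β := by
  ext i
  simp [gridPoint, mul_comm]

/-- The error of the punctured trapezoidal rule for a symbol of order `b - n`. -/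
theorem exists_forall_abs_puncturedTrapezoidal_sub_integral_le (hn : 0 < n) {m : ℕ} (hm : n < m)
    {b : ℝ} (hb0 : 0 < b) (hbm : b < m) :
    ∃ C : ℝ, 0 ≤ C ∧ ∀ (f : E n → ℝ) (B B' : ℝ), IsSymbol m (b - n) B f →
      IsSymbol m (-(n : ℝ) - 1) B' f → Integrable f ∧ ∀ h : ℝ, 0 < h →
      (Summable fun β : {β : Fin n → ℤ // β ≠ 0} => f (gridPoint h β.1)) ∧
      |puncturedTrapezoidal h f - ∫ x, f x| ≤ C * B * h ^ b := by
  obtain ⟨C, hC, H⟩ := exists_forall_abs_tsum_punctured_sub_integral_le hn hm hb0 hbm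
  refine ⟨C, hC, fun f B B' hf hf' => ⟨(H f B B' hf hf').1, fun h hh => ?_⟩⟩
  -- The bound at mesh size one is applied to `f (h • ·)`. Its constant `B * h ^ (b - n)`,
  -- multiplied by the cell volume `h ^ n`, gives `h ^ b`.
  obtain ⟨-, h2, h3⟩ := H _ _ _ (hf.comp_smul hh) (hf'.comp_smul hh)
  simp only [smul_gridPoint] at h2 h3
  refine ⟨h2, ?_⟩
  have hhn : 0 < h ^ n := pow_pos hh n
  rw [Measure.integral_comp_smul_of_nonneg volume f h (hR := hh.le), finrank_euclideanSpace_fin,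
    smul_eq_mul] at h3
  have : puncturedTrapezoidal h f - ∫ x, f x = h ^ n *
      (∑' β : {β : Fin n → ℤ // β ≠ 0}, f (gridPoint h β.1) - (h ^ n)⁻¹ * ∫ x, f x) := by
    rw [puncturedTrapezoidal, mul_sub, mul_inv_cancel_left₀ hhn.ne']
  rw [this, abs_mul, abs_of_pos hhn]
  calc _ ≤ h ^ n * (C * (B * h ^ (b - n))) := by gcongr
    _ = C * B * h ^ b := by
      rw [Real.rpow_sub hh, Real.rpow_natCast]
      field_simp

end ModTrap
end

/-! ## Invertibility of the coefficient matrix -/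

noncomputable section

namespace ModTrap

variable {n κ p : ℕ}

theorem mem_gridI {η : Fin n → ℤ} :
    η ∈ gridI n κ p ↔ (∑ j, |η j| ≤ (p : ℤ) ∧ oddProd κ η ≠ 0) ∧ ∀ j, 0 ≤ η j := by
  rw [gridI, Finset.mem_filter, mem_gridM]

theorem oddProd_ne_zero_iff {β : Fin n → ℤ} :
    oddProd κ β ≠ 0 ↔ ∀ j : Fin n, (j : ℕ) < κ → β j ≠ 0 := by
  simp [oddProd, Finset.prod_ne_zero_iff]

section Newton

/-- The Newton polynomial `∏_{i < b} (X - i²)`. -/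
def newtonPoly (b : ℕ) : Polynomial ℝ :=
  ∏ i ∈ Finset.range b, (Polynomial.X - Polynomial.C ((i : ℝ) ^ 2))

theorem newtonPoly_eval (b : ℕ) (x : ℝ) :
    (newtonPoly b).eval x = ∏ i ∈ Finset.range b, (x - (i : ℝ) ^ 2) := by
  simp [newtonPoly, Polynomial.eval_prod]

theorem newtonPoly_eval_eq_sum (b : ℕ) (x : ℝ) :
    (newtonPoly b).eval x = ∑ i ∈ Finset.range (b + 1), (newtonPoly b).coeff i * x ^ i := by
  refine Polynomial.eval_eq_sum_range' (Nat.lt_succ_of_le ?_) x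
  rw [newtonPoly, Polynomial.natDegree_finsetProd_X_sub_C_eq_card]
  simp

/-- Zero is among the nodes. Therefore, in an odd coordinate, expanding a Newton polynomial never
produces the exponent zero, which the index set excludes. -/
theorem newtonPoly_coeff_zero {b : ℕ} (hb : b ≠ 0) : (newtonPoly b).coeff 0 = 0 := by
  rw [Polynomial.coeff_zero_eq_eval_zero, newtonPoly_eval]
  exact Finset.prod_eq_zero (Finset.mem_range.2 (Nat.pos_of_ne_zero hb)) (by simp)

/-- Even monomials with exponents in the lower set `gridI` are unisolvent on `gridI`. -/
theorem eq_zero_of_forall_sum_even_monomial_eq_zero {v : gridI n κ p → ℝ}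
    (hv : ∀ ξ : gridI n κ p, ∑ η, v η * ∏ j, ((η.1 j : ℝ) ^ 2) ^ (ξ.1 j).toNat = 0) : v = 0 := by
  -- Each product of Newton polynomials is a combination of monomials with smaller exponents. Those
  -- exponents stay in the index set, except where an odd coordinate becomes zero, and there the
  -- coefficient is zero.
  have hN : ∀ ξ : gridI n κ p,
      ∑ η, v η * ∏ j, (newtonPoly (ξ.1 j).toNat).eval ((η.1 j : ℝ) ^ 2) = 0 := by
    intro ξ
    obtain ⟨⟨hξ1, hξ2⟩, hξ3⟩ := mem_gridI.1 ξ.2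
    simp only [newtonPoly_eval_eq_sum, Finset.prod_univ_sum, Finset.mul_sum]
    rw [Finset.sum_comm]
    refine Finset.sum_eq_zero fun ζ hζ => ?_
    rw [Fintype.mem_piFinset] at hζ
    simp only [Finset.prod_mul_distrib]
    by_cases hodd : ∀ j : Fin n, (j : ℕ) < κ → ζ j ≠ 0
    · have hmem : (fun j => (ζ j : ℤ)) ∈ gridI n κ p := by
        refine mem_gridI.2 ⟨⟨le_trans (Finset.sum_le_sum fun j _ => ?_) hξ1, ?_⟩, fun j => by simp⟩
        · have := Finset.mem_range.1 (hζ j)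
          have h3 := hξ3 j
          rw [abs_of_nonneg h3, abs_of_nonneg (by positivity)]
          omega
        · exact oddProd_ne_zero_iff.2 fun j hj => by exact_mod_cast hodd j hj
      have h := hv ⟨_, hmem⟩
      simp only [Int.toNat_natCast] at h
      calc _ = (∏ j, (newtonPoly (ξ.1 j).toNat).coeff (ζ j)) *
            ∑ η : gridI n κ p, v η * ∏ j, ((η.1 j : ℝ) ^ 2) ^ ζ j := by
              rw [Finset.mul_sum]
              exact Finset.sum_congr rfl fun η _ => by ring
        _ = 0 := by rw [h, mul_zero]
    · push Not at hodd
      obtain ⟨j, hj, hj0⟩ := hodd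
      have h1 : (newtonPoly (ξ.1 j).toNat).coeff (ζ j) = 0 := by
        rw [hj0]
        refine newtonPoly_coeff_zero ?_
        have := oddProd_ne_zero_iff.1 hξ2 j hj
        have := hξ3 j
        omega
      refine Finset.sum_eq_zero fun η _ => ?_
      rw [Finset.prod_eq_zero (Finset.mem_univ j) h1, zero_mul, mul_zero]
  -- Triangularity: the Newton product of `ξ` vanishes at `η` unless `ξ ≤ η` in every coordinate.
  -- For `ξ` of maximal degree in the support of `v`, only the diagonal term survives, and it is
  -- nonzero.
  by_contra hne
  obtain ⟨ξ₀, hξ₀⟩ := Function.ne_iff.1 hne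
  obtain ⟨ξ, hξ, hmax⟩ := Finset.exists_max_image (Finset.univ.filter fun η => v η ≠ 0)
    (fun η => ∑ j, η.1 j) ⟨ξ₀, by simpa using hξ₀⟩
  have hξv : v ξ ≠ 0 := by simpa using hξ
  obtain ⟨-, hξ3⟩ := mem_gridI.1 ξ.2
  have h := hN ξ
  rw [Finset.sum_eq_single ξ (fun η _ hηξ => ?_) (fun h => absurd (Finset.mem_univ _) h)] at h
  · refine (mul_ne_zero hξv (Finset.prod_ne_zero_iff.2 fun j _ => ?_)) h
    rw [newtonPoly_eval]
    refine Finset.prod_ne_zero_iff.2 fun i hi => ?_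
    have hi' : (i : ℤ) < ξ.1 j := by
      have := Finset.mem_range.1 hi
      omega
    have hlt : (i : ℝ) < (ξ.1 j : ℝ) := by exact_mod_cast hi'
    have hi0 : (0 : ℝ) ≤ i := Nat.cast_nonneg i
    nlinarith
  · by_cases hle : ∀ j, ξ.1 j ≤ η.1 j
    · have hvη : v η = 0 := by
        by_contra hvη
        have h1 := hmax η (by simpa using hvη)
        have h2 : ∀ j ∈ Finset.univ, ξ.1 j = η.1 j :=
          (Finset.sum_eq_sum_iff_of_le fun j _ => hle j).1
            (le_antisymm (Finset.sum_le_sum fun j _ => hle j) h1)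
        exact hηξ (Subtype.ext (funext fun j => (h2 j (Finset.mem_univ j)).symm))
      rw [hvη, zero_mul]
    · push Not at hle
      obtain ⟨j, hj⟩ := hle
      obtain ⟨-, hη3⟩ := mem_gridI.1 η.2
      have h0 : (newtonPoly (ξ.1 j).toNat).eval ((η.1 j : ℝ) ^ 2) = 0 := by
        rw [newtonPoly_eval]
        refine Finset.prod_eq_zero (i := (η.1 j).toNat) (Finset.mem_range.2 ?_) ?_
        · have := hη3 j
          omega
        · have : (((η.1 j).toNat : ℤ) : ℝ) = (η.1 j : ℝ) := by rw [Int.toNat_of_nonneg (hη3 j)]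
          rw [← this, Int.cast_natCast, sub_self]
      rw [Finset.prod_eq_zero (Finset.mem_univ j) h0, mul_zero]

end Newton

section Sign

theorem signOrbit_apply {β η : Fin n → ℤ} (h : β ∈ signOrbit η) (j : Fin n) :
    β j = η j ∨ β j = -η j := by
  obtain ⟨k, -, rfl⟩ := Finset.mem_image.1 h
  rcases neg_one_pow_eq_or ℤ (k j : ℕ) with h | h <;> simp [h]

theorem mem_signOrbit_self (η : Fin n → ℤ) : η ∈ signOrbit η :=
  Finset.mem_image.2 ⟨0, Finset.mem_univ _, by ext; simp⟩

theorem sign_oddProd (β : Fin n → ℤ) :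
    Int.sign (oddProd κ β) = ∏ j : Fin n, if (j : ℕ) < κ then Int.sign (β j) else 1 := by
  rw [oddProd, ← Finset.prod_filter]
  induction (Finset.univ.filter fun j : Fin n => (j : ℕ) < κ) using Finset.induction_on with
  | empty => simp
  | insert a s ha ih => rw [Finset.prod_insert ha, Finset.prod_insert ha, Int.sign_mul, ih]

theorem expo_of_lt {ξ : Fin n → ℤ} (hξ : ξ ∈ gridI n κ p) {j : Fin n} (hj : (j : ℕ) < κ) :
    expo κ ξ j + 1 = 2 * (ξ j).toNat := by
  obtain ⟨⟨-, h2⟩, h3⟩ := mem_gridI.1 hξ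
  have := h3 j
  have := oddProd_ne_zero_iff.1 h2 j hj
  simp only [expo, hj, if_true]
  omega

theorem expo_of_ge (ξ : Fin n → ℤ) {j : Fin n} (hj : ¬ (j : ℕ) < κ) :
    expo κ ξ j = 2 * (ξ j).toNat := by
  simp only [expo, hj, if_false]
  omega

/-- The exponents are odd precisely in the first `κ` coordinates, so the sign of the monomial
cancels the sign factor and all points of an orbit contribute equally. -/
theorem sign_mul_prod_pow_expo {ξ η β : Fin n → ℤ} (hξ : ξ ∈ gridI n κ p)
    (hη : η ∈ gridI n κ p) (hβ : β ∈ signOrbit η) :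
    (Int.sign (oddProd κ β) : ℝ) * ∏ j, (β j : ℝ) ^ expo κ ξ j = ∏ j, (η j : ℝ) ^ expo κ ξ j := by
  obtain ⟨⟨-, h2⟩, h3⟩ := mem_gridI.1 hη
  rw [sign_oddProd, Int.cast_prod, ← Finset.prod_mul_distrib]
  refine Finset.prod_congr rfl fun j _ => ?_
  by_cases hj : (j : ℕ) < κ
  · have hpos : 0 < η j := lt_of_le_of_ne (h3 j) (oddProd_ne_zero_iff.1 h2 j hj).symm
    have hodd : Odd (expo κ ξ j) := by
      have := expo_of_lt hξ hj
      exact ⟨(ξ j).toNat - 1, by omega⟩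
    simp only [hj, if_true]
    rcases signOrbit_apply hβ j with h | h
    · rw [h, Int.sign_eq_one_of_pos hpos]; simp
    · rw [h, Int.sign_neg, Int.sign_eq_one_of_pos hpos]
      push_cast
      rw [hodd.neg_pow]
      ring
  · have heven : Even (expo κ ξ j) := ⟨(ξ j).toNat, by rw [expo_of_ge ξ hj]; ring⟩
    simp only [hj, if_false, Int.cast_one, one_mul]
    rcases signOrbit_apply hβ j with h | h
    · rw [h]
    · rw [h]
      push_cast
      rw [heven.neg_pow]

theorem matK_apply (ξ η : gridI n κ p) :
    matK n κ p ξ η = (signOrbit η.1).card * ∏ j, (η.1 j : ℝ) ^ expo κ ξ.1 j := by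
  rw [matK, Matrix.of_apply, Finset.sum_congr rfl fun β hβ => sign_mul_prod_pow_expo ξ.2 η.2 hβ,
    Finset.sum_const, nsmul_eq_mul]

/-- Multiplying column `η` by the product of its first `κ` entries raises the exponents `2ξ - ∑ e_j`
to `2ξ`. A kernel vector thus becomes, after rescaling by nonzero factors, a relation among even
monomials, which unisolvence excludes. -/
theorem isUnit_matK : IsUnit (matK n κ p) := by
  rw [← Matrix.mulVec_injective_iff_isUnit]
  have hinj : ∀ w : gridI n κ p → ℝ, matK n κ p *ᵥ w = 0 → w = 0 := by
    intro w hw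
    have hodd : ∀ η : gridI n κ p, (oddProd κ η.1 : ℝ) ≠ 0 := fun η => by
      exact_mod_cast (mem_gridI.1 η.2).1.2
    have hcard : ∀ η : gridI n κ p, ((signOrbit η.1).card : ℝ) ≠ 0 := fun η => by
      exact_mod_cast (Finset.card_pos.2 ⟨_, mem_signOrbit_self η.1⟩).ne'
    have hv := eq_zero_of_forall_sum_even_monomial_eq_zero
      (v := fun η : gridI n κ p => w η * (signOrbit η.1).card / oddProd κ η.1) fun ξ => by
        have h := congr_fun hw ξ
        simp only [Matrix.mulVec, dotProduct, matK_apply, Pi.zero_apply] at h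
        rw [← h]
        refine Finset.sum_congr rfl fun η _ => ?_
        have hprod : ∏ j, ((η.1 j : ℝ) ^ 2) ^ (ξ.1 j).toNat =
            oddProd κ η.1 * ∏ j, (η.1 j : ℝ) ^ expo κ ξ.1 j := by
          rw [oddProd, Int.cast_prod, Finset.prod_filter, ← Finset.prod_mul_distrib]
          refine Finset.prod_congr rfl fun j _ => ?_
          by_cases hj : (j : ℕ) < κ
          · rw [if_pos hj, ← pow_mul, ← expo_of_lt ξ.2 hj, pow_succ, mul_comm]
          · rw [if_neg hj, ← pow_mul, ← expo_of_ge ξ.1 hj, one_mul]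
        rw [hprod]
        field_simp [hodd η]
    ext η
    have := congr_fun hv η
    simpa [hodd η, hcard η] using this
  intro w w' h
  have h' : matK n κ p *ᵥ (w - w') = 0 := by
    rw [Matrix.mulVec_sub]
    exact sub_eq_zero.2 h
  exact sub_eq_zero.1 (hinj _ h')

end Sign

end ModTrap
end

/-! ## Taylor expansion at the origin -/

noncomputable section

namespace ModTrap

section Symmetry

variable {V : Type*} [NormedAddCommGroup V] [NormedSpace ℝ V]

/-- Schwarz's theorem for the second derivative of the `j`-th derivative; the first two slots of the
multilinear map are the two outermost differentiations. -/
theorem iteratedFDeriv_swap_zero_one {j : ℕ} {f : V → ℝ} (hf : ContDiff ℝ (j + 2 : ℕ) f) (x : V)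
    (v : Fin (j + 2) → V) :
    iteratedFDeriv ℝ (j + 2) f x (v ∘ Equiv.swap 0 1) = iteratedFDeriv ℝ (j + 2) f x v := by
  have hD : ContDiff ℝ 2 (iteratedFDeriv ℝ j f) :=
    hf.iteratedFDeriv_right (by norm_cast; omega)
  have hsymm : IsSymmSndFDerivAt ℝ (iteratedFDeriv ℝ j f) x :=
    hD.contDiffAt.isSymmSndFDerivAt (by simp)
  have key : ∀ w : Fin (j + 2) → V, iteratedFDeriv ℝ (j + 2) f x w =
      fderiv ℝ (fderiv ℝ (iteratedFDeriv ℝ j f)) x (w 0) (w 1) (Fin.tail (Fin.tail w)) := by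
    intro w
    have hd1 : DifferentiableAt ℝ (iteratedFDeriv ℝ (j + 1) f) x :=
      hf.differentiable_iteratedFDeriv (by norm_cast; omega) x
    have hd2 : DifferentiableAt ℝ (fderiv ℝ (iteratedFDeriv ℝ j f)) x :=
      (hD.fderiv_right (m := 1) (by norm_num)).differentiable one_ne_zero x
    have hc : HasFDerivAt (fun y => fderiv ℝ (iteratedFDeriv ℝ j f) y (Fin.tail w 0))
        ((fderiv ℝ (fderiv ℝ (iteratedFDeriv ℝ j f)) x).flip (Fin.tail w 0)) x := by
      simpa using hd2.hasFDerivAt.clm_apply (hasFDerivAt_const (Fin.tail w 0) x)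
    rw [hd1.iteratedFDeriv_succ_apply_left']
    simp only [iteratedFDeriv_succ_apply_left]
    rw [fderiv_continuousMultilinear_apply_const_apply hc.differentiableAt, hc.fderiv]
    rfl
  have ht : Fin.tail (Fin.tail (v ∘ Equiv.swap 0 1)) = Fin.tail (Fin.tail v) := by
    ext i
    simp only [Fin.tail, Function.comp_apply]
    rw [Equiv.swap_apply_of_ne_of_ne] <;> simp [Fin.ext_iff]
  rw [key, key, ht, Function.comp_apply, Function.comp_apply, Equiv.swap_apply_left,
    Equiv.swap_apply_right, hsymm]

/-- The `j`-th derivative of a `C^j` function is symmetric. -/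
theorem iteratedFDeriv_comp_perm_of_contDiff {j : ℕ} {f : V → ℝ} (hf : ContDiff ℝ j f) (x : V)
    (v : Fin j → V) (σ : Equiv.Perm (Fin j)) :
    iteratedFDeriv ℝ j f x (v ∘ σ) = iteratedFDeriv ℝ j f x v := by
  induction j generalizing x with
  | zero => rw [Subsingleton.elim (v ∘ σ) v]
  | succ j ih =>
    -- Adjacent transpositions generate the permutations. The one exchanging the first two slots is
    -- Schwarz's theorem; every other one fixes slot zero and acts on the tail, where the induction
    -- hypothesis applies before the outermost differentiation.
    have hσ : σ ∈ Submonoid.closure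
        (Set.range fun i : Fin j => Equiv.swap i.castSucc i.succ) := by
      rw [Equiv.Perm.mclosure_swap_castSucc_succ]; trivial
    induction hσ using Submonoid.closure_induction generalizing v with
    | one => simp
    | mul σ τ _ _ h₁ h₂ =>
      rw [Equiv.Perm.coe_mul, ← Function.comp_assoc, h₂, h₁]
    | mem σ hσ =>
      obtain ⟨i, rfl⟩ := hσ
      obtain _ | j := j
      · exact i.elim0
      induction i using Fin.cases with
      | zero => exact iteratedFDeriv_swap_zero_one hf x v
      | succ i =>
        have hd : DifferentiableAt ℝ (iteratedFDeriv ℝ (j + 1) f) x :=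
          hf.differentiable_iteratedFDeriv (by norm_cast; omega) x
        have h0 : (v ∘ Equiv.swap i.succ.castSucc i.succ.succ) 0 = v 0 := by
          rw [Function.comp_apply, Equiv.swap_apply_of_ne_of_ne] <;> simp [Fin.ext_iff]
        have ht : Fin.tail (v ∘ Equiv.swap i.succ.castSucc i.succ.succ) =
            Fin.tail v ∘ Equiv.swap i.castSucc i.succ := by
          ext k
          simp only [Fin.tail, Function.comp_apply]
          rw [← Fin.succ_castSucc, (Fin.succ_injective _).swap_apply]
        rw [hd.iteratedFDeriv_succ_apply_left', hd.iteratedFDeriv_succ_apply_left', h0, ht]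
        congr 2
        ext y
        exact ih (hf.of_le (by norm_cast; omega)) y _ _

end Symmetry

section Taylor

variable {V : Type*} [NormedAddCommGroup V] [NormedSpace ℝ V]

/-- Scaling the argument by `t` multiplies the derivative at the origin by `t ^ d`, while the chain
rule allows at most `t ^ j`. If `d ≠ j`, either `t = 1 / 2` or `t = 2` contradicts this unless the
derivative is zero. -/
theorem iteratedFDeriv_zero_of_homogeneous {f : V → ℝ} {d j : ℕ} (hdj : d ≠ j)
    (hhom : ∀ t : ℝ, 0 < t → ∀ x, f (t • x) = t ^ d * f x) (hf : ContDiff ℝ j f) :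
    iteratedFDeriv ℝ j f 0 = 0 := by
  have key : ∀ t : ℝ, 0 < t →
      t ^ d * ‖iteratedFDeriv ℝ j f 0‖ ≤ t ^ j * ‖iteratedFDeriv ℝ j f 0‖ := fun t ht => by
    have h := norm_iteratedFDeriv_comp_smul_le f ht.ne' j 0
    have : iteratedFDeriv ℝ j (fun y => f (t • y)) 0 = t ^ d • iteratedFDeriv ℝ j f 0 := by
      rw [show (fun y => f (t • y)) = t ^ d • f from funext fun x => hhom t ht x]
      exact iteratedFDeriv_const_smul_apply hf.contDiffAt
    rwa [this, norm_smul, Real.norm_eq_abs, abs_of_pos (pow_pos ht d), abs_of_pos ht,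
      smul_zero] at h
  rw [← norm_eq_zero]
  by_contra hne
  have hpos : 0 < ‖iteratedFDeriv ℝ j f 0‖ := lt_of_le_of_ne (norm_nonneg _) (Ne.symm hne)
  rcases lt_or_gt_of_ne hdj with h | h
  · have h1 := le_of_mul_le_mul_right (key (1 / 2) (by norm_num)) hpos
    exact absurd h1 (not_le.2 (pow_lt_pow_right_of_lt_one₀ (by norm_num) (by norm_num) h))
  · have h1 := le_of_mul_le_mul_right (key 2 (by norm_num)) hpos
    exact absurd h1 (not_le.2 (pow_lt_pow_right₀ (by norm_num) h))

/-- The homogeneous part of degree `j` of the Taylor expansion of `f` at the origin. -/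
def taylorPart (f : V → ℝ) (j : ℕ) (x : V) : ℝ :=
  (j.factorial : ℝ)⁻¹ * iteratedFDeriv ℝ j f 0 fun _ => x

theorem contDiff_taylorPart (f : V → ℝ) (j : ℕ) {m : ℕ∞ω} : ContDiff ℝ m (taylorPart f j) :=
  contDiff_const.mul ((iteratedFDeriv ℝ j f 0).contDiff.comp (contDiff_pi.2 fun _ => contDiff_id))

theorem taylorPart_smul (f : V → ℝ) (j : ℕ) (t : ℝ) (x : V) :
    taylorPart f j (t • x) = t ^ j * taylorPart f j x := by
  have := (iteratedFDeriv ℝ j f 0).map_smul_univ (fun _ => t) (fun _ => x)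
  simp only [Finset.prod_const, Finset.card_univ, Fintype.card_fin, smul_eq_mul] at this
  rw [taylorPart, taylorPart, this]
  ring

/-- Differentiating a multilinear map on the diagonal sums over all permutations of its arguments.
By symmetry this gives `j!` equal terms, cancelling the factorial; all other orders vanish by
homogeneity. -/
theorem iteratedFDeriv_taylorPart {f : V → ℝ} {j l : ℕ} (hf : ContDiff ℝ j f) :
    iteratedFDeriv ℝ l (taylorPart f j) 0 = if l = j then iteratedFDeriv ℝ l f 0 else 0 := by
  split_ifs with h
  · subst h
    ext v
    have hc : ContDiff ℝ l (fun x : V => iteratedFDeriv ℝ l f 0 fun _ => x) :=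
      (iteratedFDeriv ℝ l f 0).contDiff.comp (contDiff_pi.2 fun _ => contDiff_id)
    have h1 : iteratedFDeriv ℝ l (taylorPart f l) 0 = (l.factorial : ℝ)⁻¹ •
        iteratedFDeriv ℝ l (fun x : V => iteratedFDeriv ℝ l f 0 fun _ => x) 0 :=
      iteratedFDeriv_const_smul_apply (a := (l.factorial : ℝ)⁻¹)
        (f := fun x : V => iteratedFDeriv ℝ l f 0 fun _ => x) hc.contDiffAt
    rw [h1, smul_apply,
      ContinuousMultilinearMap.iteratedFDeriv_comp_diagonal]
    have h2 : ∀ σ : Equiv.Perm (Fin l), iteratedFDeriv ℝ l f 0 (fun i => v (σ i)) =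
        iteratedFDeriv ℝ l f 0 v := fun σ => iteratedFDeriv_comp_perm_of_contDiff hf 0 v σ
    simp only [h2, Finset.sum_const, Finset.card_univ, Fintype.card_perm, Fintype.card_fin,
      smul_eq_mul, nsmul_eq_mul]
    rw [inv_mul_cancel_left₀ (by positivity)]
  · exact iteratedFDeriv_zero_of_homogeneous (Ne.symm h)
      (fun t _ x => taylorPart_smul f j t x) (contDiff_taylorPart f j)

theorem iteratedFDeriv_sub_taylor {f : V → ℝ} {M l : ℕ} (hf : ContDiff ℝ M f) (hl : l ≤ M) :
    iteratedFDeriv ℝ l (fun x => f x - ∑ j ∈ Finset.range (M + 1), taylorPart f j x) 0 = 0 := by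
  have hs : ContDiff ℝ l (fun x => ∑ j ∈ Finset.range (M + 1), taylorPart f j x) :=
    ContDiff.sum fun j _ => contDiff_taylorPart f j
  have h1 : iteratedFDeriv ℝ l (fun x => f x - ∑ j ∈ Finset.range (M + 1), taylorPart f j x) 0 =
      iteratedFDeriv ℝ l f 0 -
        iteratedFDeriv ℝ l (fun x => ∑ j ∈ Finset.range (M + 1), taylorPart f j x) 0 :=
    iteratedFDeriv_sub_apply (hf.of_le (by exact_mod_cast hl)).contDiffAt hs.contDiffAt
  have h2 : iteratedFDeriv ℝ l (fun x => ∑ j ∈ Finset.range (M + 1), taylorPart f j x) 0 =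
      ∑ j ∈ Finset.range (M + 1), iteratedFDeriv ℝ l (taylorPart f j) 0 := by
    have := iteratedFDeriv_sum (𝕜 := ℝ) (i := l) (u := Finset.range (M + 1))
      (f := fun j => taylorPart f j) fun j _ => contDiff_taylorPart f j
    rw [this]
    simp
  have h3 : ∀ j ∈ Finset.range (M + 1), iteratedFDeriv ℝ l (taylorPart f j) 0 =
      if l = j then iteratedFDeriv ℝ l f 0 else 0 := fun j hj =>
    iteratedFDeriv_taylorPart
      (hf.of_le (by exact_mod_cast Nat.lt_succ_iff.1 (Finset.mem_range.1 hj)))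
  rw [h1, h2, Finset.sum_congr rfl h3, Finset.sum_ite_eq,
    if_pos (Finset.mem_range.2 (Nat.lt_succ_of_le hl)), sub_self]

end Taylor

variable {n : ℕ}

/-- The multi-index that counts the values of `i`. -/
def countIndex {j : ℕ} (i : Fin j → Fin n) (l : Fin n) : ℕ :=
  (Finset.univ.filter fun a => i a = l).card

theorem sum_countIndex {j : ℕ} (i : Fin j → Fin n) : ∑ l, countIndex i l = j := by
  have := Finset.card_eq_sum_card_fiberwise (s := Finset.univ) (t := Finset.univ) (f := i)
    (by simp)
  simpa [countIndex] using this.symm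

theorem prod_eq_monomial_countIndex {j : ℕ} (i : Fin j → Fin n) (x : E n) :
    ∏ a, x (i a) = monomial (countIndex i) x := by
  rw [monomial, ← Finset.prod_fiberwise_of_maps_to (g := i) (t := Finset.univ) (by simp)]
  refine Finset.prod_congr rfl fun l _ => ?_
  rw [Finset.prod_congr rfl fun a ha => by rw [(Finset.mem_filter.1 ha).2], Finset.prod_const]
  rfl

/-- Summing over index functions `Fin j → Fin n` rather than multi-indices lets repeated monomials
absorb the multinomial coefficients. -/
theorem taylorPart_eq_sum_monomial (f : E n → ℝ) (j : ℕ) (x : E n) :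
    taylorPart f j x = ∑ i : Fin j → Fin n, (j.factorial : ℝ)⁻¹ *
      iteratedFDeriv ℝ j f 0 (fun a => EuclideanSpace.single (i a) (1 : ℝ)) *
        monomial (countIndex i) x := by
  have hx : x = ∑ l, x l • (EuclideanSpace.single l (1 : ℝ) : E n) := by
    ext k; simp [Pi.single_apply]
  have h : iteratedFDeriv ℝ j f 0 (fun _ => x) = ∑ i : Fin j → Fin n,
      (∏ a, x (i a)) * iteratedFDeriv ℝ j f 0
        (fun a => EuclideanSpace.single (i a) (1 : ℝ)) := by
    conv_lhs => rw [hx]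
    rw [ContinuousMultilinearMap.map_sum]
    refine Finset.sum_congr rfl fun i _ => ?_
    rw [ContinuousMultilinearMap.map_smul_univ, smul_eq_mul]
  rw [taylorPart, h, Finset.mul_sum]
  refine Finset.sum_congr rfl fun i _ => ?_
  rw [prod_eq_monomial_countIndex]
  ring

theorem iteratedFDeriv_eq_zero_of_partials {f : E n → ℝ} {M j : ℕ} (h : PartialsVanish f M)
    (hj1 : 1 ≤ j) (hj : j ≤ M) : iteratedFDeriv ℝ j f 0 = 0 := by
  refine ContinuousMultilinearMap.toMultilinearMap_injective ?_
  refine Module.Basis.ext_multilinear (fun _ => (EuclideanSpace.basisFun (Fin n) ℝ).toBasis)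
    fun v => ?_
  simpa using h j hj1 hj v

end ModTrap
end

/-! ## Kernels, reflections and parity -/

noncomputable section

namespace ModTrap
open MeasureTheory Filter

variable {n κ p : ℕ}

theorem IsKernel.dim_pos {δ : ℝ} {s : E n → ℝ} (hs : IsKernel n κ δ s) : 0 < n := by
  have h := hs.delta_pos.trans hs.delta_lt
  exact_mod_cast h

theorem IsKernel.smul {δ : ℝ} {s : E n → ℝ} (hs : IsKernel n κ δ s) {t : ℝ} (ht : 0 < t)
    {x : E n} (hx : x ≠ 0) : s (t • x) = t ^ (δ - n) * s x := by
  obtain ⟨ρ, -, -, h⟩ := hs.dilation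
  have hpos : 0 < ‖x‖ := norm_pos_iff.2 hx
  rw [h x hx, h (t • x) (smul_ne_zero ht.ne' hx), norm_smul, Real.norm_eq_abs, abs_of_pos ht,
    Real.mul_rpow ht.le hpos.le, smul_smul, mul_assoc]
  congr 4
  field_simp

theorem IsKernel.exists_isSymbol {δ : ℝ} {s : E n → ℝ} (hs : IsKernel n κ δ s) (m : ℕ) :
    ∃ B, IsSymbol m (δ - n) B s :=
  exists_isSymbol_of_homogeneous m (hs.smooth.of_le (by exact_mod_cast le_top))
    fun _ ht _ hx => hs.smul ht hx

theorem contDiff_monomial (k : Fin n → ℕ) {m : ℕ∞ω} : ContDiff ℝ m (monomial (n := n) k) := by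
  unfold monomial
  exact contDiff_prod fun j _ => ContDiff.pow (contDiff_piLp_apply (p := 2)) _

theorem monomial_smul (k : Fin n → ℕ) (t : ℝ) (x : E n) :
    monomial k (t • x) = t ^ (∑ j, k j) * monomial k x := by
  simp [monomial, mul_pow, Finset.prod_mul_distrib, Finset.prod_pow_eq_pow_sum]

theorem exists_isSymbol_monomial (m : ℕ) (k : Fin n → ℕ) :
    ∃ B, IsSymbol m ((∑ j, k j : ℕ) : ℝ) B (monomial (n := n) k) :=
  exists_isSymbol_of_homogeneous m (contDiff_monomial k).contDiffOn fun t _ x _ => by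
    rw [monomial_smul, Real.rpow_natCast]

theorem norm_gridPoint {h : ℝ} (hh : 0 ≤ h) (β : Fin n → ℤ) :
    ‖(gridPoint h β : E n)‖ = h * ‖(gridPoint 1 β : E n)‖ := by
  rw [← smul_gridPoint, norm_smul, Real.norm_eq_abs, abs_of_nonneg hh]

theorem gridPoint_ne_zero {h : ℝ} (hh : 0 < h) {β : Fin n → ℤ} (hβ : β ≠ 0) :
    (gridPoint h β : E n) ≠ 0 := by
  rw [← norm_pos_iff, norm_gridPoint hh.le]
  have := one_le_norm_gridPoint hβ
  positivity

theorem monomial_gridPoint (k : Fin n → ℕ) (h : ℝ) (β : Fin n → ℤ) :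
    monomial k (gridPoint h β) = h ^ (∑ j, k j) * ∏ j, (β j : ℝ) ^ k j := by
  rw [← smul_gridPoint, monomial_smul]
  simp [monomial, gridPoint]

section Reflection

/-- The reflection in the `j`-th coordinate as a linear isometry. -/
def reflectIsometry (j : Fin n) : E n ≃ₗᵢ[ℝ] E n :=
  LinearIsometryEquiv.piLpCongrRight 2 fun i =>
    if i = j then LinearIsometryEquiv.neg ℝ else LinearIsometryEquiv.refl ℝ ℝ

theorem reflect_apply (j : Fin n) (x : E n) (i : Fin n) :
    reflect j x i = if i = j then -x i else x i := by
  by_cases h : i = j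
  · subst h; simp [reflect]
  · simp [reflect, h]

theorem reflectIsometry_apply (j : Fin n) (x : E n) : reflectIsometry j x = reflect j x := by
  ext i
  rw [reflect_apply]
  by_cases h : i = j <;> simp [reflectIsometry, h]

theorem norm_reflect (j : Fin n) (x : E n) : ‖reflect j x‖ = ‖x‖ := by
  rw [← reflectIsometry_apply, LinearIsometryEquiv.norm_map]

theorem monomial_reflect (k : Fin n → ℕ) (j : Fin n) (x : E n) :
    monomial k (reflect j x) = (-1) ^ k j * monomial k x := by
  have : ∀ i, reflect j x i ^ k i = (if i = j then (-1) ^ k i else 1) * x i ^ k i := fun i => by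
    rw [reflect_apply]
    split_ifs
    · rw [neg_pow]
    · rw [one_mul]
  simp only [monomial, this, Finset.prod_mul_distrib, Finset.prod_ite_eq', Finset.mem_univ, if_true]

/-- The reflection of the integer lattice in the `j`-th coordinate. -/
def reflectLattice (j : Fin n) (β : Fin n → ℤ) : Fin n → ℤ := fun i => if i = j then -β i else β i

theorem reflectLattice_involutive (j : Fin n) : Function.Involutive (reflectLattice j) := by
  intro β
  ext i
  by_cases h : i = j <;> simp [reflectLattice, h]

theorem reflectLattice_ne_zero {j : Fin n} {β : Fin n → ℤ} (hβ : β ≠ 0) :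
    reflectLattice j β ≠ 0 := by
  intro h
  have h2 := reflectLattice_involutive j β
  rw [h] at h2
  apply hβ
  rw [← h2]
  ext i
  simp [reflectLattice]

theorem gridPoint_reflectLattice (h : ℝ) (j : Fin n) (β : Fin n → ℤ) :
    (gridPoint h (reflectLattice j β) : E n) = reflect j (gridPoint h β) := by
  ext i
  rw [reflect_apply]
  by_cases hi : i = j <;> simp [gridPoint, reflectLattice, hi]

theorem integral_eq_zero_of_reflect (hn : 0 < n) {f : E n → ℝ} {j : Fin n}
    (hf : ∀ x ≠ 0, f (reflect j x) = -f x) : ∫ x, f x = 0 := by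
  have : Nonempty (Fin n) := ⟨⟨0, hn⟩⟩
  have h1 : ∫ x, f (reflectIsometry j x) = ∫ x, f x :=
    (reflectIsometry j).measurePreserving.integral_comp
      (reflectIsometry j).toMeasurableEquiv.measurableEmbedding f
  have hne : ∀ᵐ x : E n, x ≠ 0 := by simp [ae_iff]
  have h2 : ∫ x, f (reflectIsometry j x) = ∫ x, -f x :=
    integral_congr_ae (hne.mono fun x hx => by
      simp only [reflectIsometry_apply]; exact hf x hx)
  rw [integral_neg] at h2
  linarith

theorem puncturedTrapezoidal_eq_zero_of_reflect {f : E n → ℝ} {j : Fin n}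
    (hf : ∀ x ≠ 0, f (reflect j x) = -f x) {h : ℝ} (hh : 0 < h) :
    puncturedTrapezoidal h f = 0 := by
  let e : {β : Fin n → ℤ // β ≠ 0} ≃ {β : Fin n → ℤ // β ≠ 0} :=
    { toFun := fun β => ⟨reflectLattice j β.1, reflectLattice_ne_zero β.2⟩
      invFun := fun β => ⟨reflectLattice j β.1, reflectLattice_ne_zero β.2⟩
      left_inv := fun β => Subtype.ext (reflectLattice_involutive j β.1)
      right_inv := fun β => Subtype.ext (reflectLattice_involutive j β.1) }
  have h1 := e.tsum_eq fun β : {β : Fin n → ℤ // β ≠ 0} => f (gridPoint h β.1)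
  have h2 : ∀ β : {β : Fin n → ℤ // β ≠ 0}, f (gridPoint h (e β).1) = -f (gridPoint h β.1) :=
    fun β => by
      change f (gridPoint h (reflectLattice j β.1)) = _
      rw [gridPoint_reflectLattice]
      exact hf _ (gridPoint_ne_zero hh β.2)
  simp only [h2, tsum_neg] at h1
  rw [puncturedTrapezoidal]
  have : ∑' β : {β : Fin n → ℤ // β ≠ 0}, f (gridPoint h β.1) = 0 := by linarith
  rw [this, mul_zero]

theorem mem_signOrbit {β η : Fin n → ℤ} :
    β ∈ signOrbit η ↔ ∀ i, β i = η i ∨ β i = -η i := by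
  refine ⟨fun h => signOrbit_apply h, fun h => ?_⟩
  refine Finset.mem_image.2 ⟨fun i => if β i = η i then 0 else 1, Finset.mem_univ _, ?_⟩
  ext i
  by_cases hi : β i = η i
  · simp [hi]
  · simp [hi]
    exact ((h i).resolve_left hi).symm

theorem reflectLattice_mem_signOrbit {β η : Fin n → ℤ} (j : Fin n) (h : β ∈ signOrbit η) :
    reflectLattice j β ∈ signOrbit η := by
  rw [mem_signOrbit] at h ⊢
  intro i
  have := h i
  simp only [reflectLattice]
  split_ifs
  · omega
  · exact this

theorem sign_oddProd_reflectLattice (j : Fin n) (β : Fin n → ℤ) :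
    Int.sign (oddProd κ (reflectLattice j β)) =
      (if (j : ℕ) < κ then -1 else 1) * Int.sign (oddProd κ β) := by
  rw [sign_oddProd, sign_oddProd]
  have : ∀ i : Fin n, (if (i : ℕ) < κ then Int.sign (reflectLattice j β i) else 1) =
      (if i = j then (if (i : ℕ) < κ then -1 else 1) else 1) *
        (if (i : ℕ) < κ then Int.sign (β i) else 1) := fun i => by
    simp only [reflectLattice]
    split_ifs <;> simp
  simp only [this, Finset.prod_mul_distrib, Finset.prod_ite_eq', Finset.mem_univ, if_true]

/-- The hypothesis says that `f` has the opposite of the kernel's parity in coordinate `j`. The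
reflection permutes the orbit and changes the sign factor with the kernel's parity, so the sum
equals its own negative. -/
theorem orbitSum_eq_zero_of_reflect {f : E n → ℝ} {j : Fin n}
    (hf : ∀ x, f (reflect j x) = -((if (j : ℕ) < κ then -1 else 1) * f x)) (h : ℝ)
    (η : Fin n → ℤ) :
    ∑ β ∈ signOrbit η, (Int.sign (oddProd κ β) : ℝ) * f (gridPoint h β) = 0 := by
  have h1 : ∑ β ∈ signOrbit η, (Int.sign (oddProd κ β) : ℝ) * f (gridPoint h β) =
      ∑ β ∈ signOrbit η, -((Int.sign (oddProd κ β) : ℝ) * f (gridPoint h β)) := by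
    refine Finset.sum_nbij' (reflectLattice j) (reflectLattice j)
      (fun β hβ => reflectLattice_mem_signOrbit j hβ)
      (fun β hβ => reflectLattice_mem_signOrbit j hβ)
      (fun β _ => reflectLattice_involutive j β) (fun β _ => reflectLattice_involutive j β)
      fun β _ => ?_
    rw [gridPoint_reflectLattice, hf, sign_oddProd_reflectLattice]
    split_ifs <;> push_cast <;> ring
  rw [Finset.sum_neg_distrib] at h1
  linarith

theorem norm_gridPoint_of_mem_signOrbit {β η : Fin n → ℤ} (hβ : β ∈ signOrbit η) (h : ℝ) :
    ‖(gridPoint h β : E n)‖ = ‖(gridPoint h η : E n)‖ := by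
  rw [EuclideanSpace.norm_eq, EuclideanSpace.norm_eq]
  congr 1
  refine Finset.sum_congr rfl fun i _ => ?_
  rcases mem_signOrbit.1 hβ i with hi | hi <;> simp [gridPoint, hi]

end Reflection

section Exponents

theorem card_filter_lt (hκ : κ ≤ n) :
    (Finset.univ.filter fun j : Fin n => (j : ℕ) < κ).card = κ := by
  rw [Fin.card_filter_val_lt]
  exact min_eq_right hκ

theorem sum_expo {ξ : Fin n → ℤ} (hκ : κ ≤ n) (hξ : ξ ∈ gridI n κ p) :
    ((∑ j, expo κ ξ j : ℕ) : ℝ) = 2 * (∑ j, |(ξ j : ℝ)|) - κ := by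
  obtain ⟨-, h3⟩ := mem_gridI.1 hξ
  have h : ∀ j, (expo κ ξ j : ℝ) = 2 * |(ξ j : ℝ)| - if (j : ℕ) < κ then 1 else 0 := fun j => by
    have hj : |(ξ j : ℝ)| = ((ξ j).toNat : ℝ) := by
      rw [abs_of_nonneg (by exact_mod_cast h3 j)]
      exact_mod_cast (Int.toNat_of_nonneg (h3 j)).symm
    rw [hj]
    by_cases hlt : (j : ℕ) < κ
    · have := expo_of_lt hξ hlt
      have h' : (expo κ ξ j : ℝ) + 1 = 2 * ((ξ j).toNat : ℝ) := by exact_mod_cast this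
      rw [if_pos hlt]; linarith
    · rw [if_neg hlt, expo_of_ge ξ hlt]; push_cast; ring
  push_cast
  rw [Finset.sum_congr rfl fun j _ => h j, Finset.sum_sub_distrib, ← Finset.mul_sum]
  congr 1
  rw [Finset.sum_ite, Finset.sum_const_zero, add_zero, Finset.sum_const, card_filter_lt hκ]
  simp

/-- A multi-index with the parity of the kernel is of the form `2ξ - ∑ e_j`. -/
theorem exists_expo_eq (hκ : κ ≤ n) (hp : κ ≤ 2 * p) {k : Fin n → ℕ}
    (hk : ∑ j, k j ≤ 2 * p - κ + 1) (hodd : ∀ j : Fin n, (j : ℕ) < κ → Odd (k j))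
    (heven : ∀ j : Fin n, ¬ (j : ℕ) < κ → Even (k j)) :
    ∃ ξ ∈ gridI n κ p, expo κ ξ = k := by
  have hex : ∀ j : Fin n, ∃ z : ℕ, 2 * z = k j + if (j : ℕ) < κ then 1 else 0 := fun j => by
    by_cases hj : (j : ℕ) < κ
    · obtain ⟨a, ha⟩ := hodd j hj
      exact ⟨a + 1, by rw [if_pos hj]; omega⟩
    · obtain ⟨a, ha⟩ := heven j hj
      exact ⟨a, by rw [if_neg hj]; omega⟩
  choose z hz using hex
  have hsum : 2 * ∑ j, z j = ∑ j, k j + κ := by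
    rw [Finset.mul_sum, Finset.sum_congr rfl fun j _ => hz j, Finset.sum_add_distrib]
    congr 1
    rw [Finset.sum_ite, Finset.sum_const_zero, add_zero, Finset.sum_const, card_filter_lt hκ]
    simp
  refine ⟨fun j => (z j : ℤ), mem_gridI.2 ⟨⟨?_, ?_⟩, fun j => Int.natCast_nonneg _⟩, ?_⟩
  · simp only [Nat.abs_cast]
    -- Here `2 ∑ z_j = ∑ k_j + κ ≤ 2p + 1`, and integrality absorbs the extra one. This is why
    -- degrees up to `2p - κ + 1` are covered.
    have : ∑ j, z j ≤ p := by omega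
    exact_mod_cast this
  · refine oddProd_ne_zero_iff.2 fun j hj => ?_
    have := hz j
    rw [if_pos hj] at this
    have : z j ≠ 0 := by omega
    exact_mod_cast this
  · ext j
    have := hz j
    by_cases hj : (j : ℕ) < κ
    · rw [if_pos hj] at this
      simp only [expo, if_pos hj]; omega
    · rw [if_neg hj] at this
      simp only [expo, if_neg hj]; omega

end Exponents

/-- A function whose oscillation near the origin is controlled by a power has a limit with the
same rate. -/
theorem exists_forall_abs_sub_le_rpow {e : ℝ → ℝ} {C q : ℝ} (hq : 0 < q)
    (he : ∀ h > 0, ∀ h' > 0, |e h - e h'| ≤ C * (h ^ q + h' ^ q)) :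
    ∃ L, ∀ h > 0, |e h - L| ≤ C * h ^ q := by
  have hC : 0 ≤ C := by
    have := (abs_nonneg _).trans (he 1 one_pos 1 one_pos)
    simp only [Real.one_rpow] at this
    linarith
  set a : ℕ → ℝ := fun k => 1 / ((k : ℝ) + 1) with ha
  have hapos : ∀ k, 0 < a k := fun k => by simp only [ha]; positivity
  have ha0 : Tendsto (fun k => a k ^ q) atTop (𝓝 0) := by
    have := (tendsto_one_div_add_atTop_nhds_zero_nat (𝕜 := ℝ)).rpow_const (p := q) (Or.inr hq.le)
    rwa [Real.zero_rpow hq.ne'] at this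
  have hcauchy : CauchySeq fun k => e (a k) := by
    refine cauchySeq_of_le_tendsto_0 (fun N => C * (a N ^ q + a N ^ q)) (fun k l N hk hl => ?_) ?_
    · rw [Real.dist_eq]
      refine (he _ (hapos k) _ (hapos l)).trans ?_
      have hm : ∀ i, N ≤ i → a i ^ q ≤ a N ^ q := fun i hi => by
        refine Real.rpow_le_rpow (hapos i).le ?_ hq.le
        simp only [ha]
        gcongr
      exact mul_le_mul_of_nonneg_left (add_le_add (hm k hk) (hm l hl)) hC
    · simpa using (ha0.add ha0).const_mul C
  obtain ⟨L, hL⟩ := cauchySeq_tendsto_of_complete hcauchy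
  refine ⟨L, fun h hh => ?_⟩
  have h1 : Tendsto (fun k => |e h - e (a k)|) atTop (𝓝 |e h - L|) :=
    (tendsto_const_nhds.sub hL).abs
  have h2 : Tendsto (fun k => C * (h ^ q + a k ^ q)) atTop (𝓝 (C * h ^ q)) := by
    simpa using (ha0.const_add (h ^ q)).const_mul C
  exact le_of_tendsto_of_tendsto' h1 h2 fun k => he h hh _ (hapos k)

end ModTrap
end

/-! ## Convergence of the right-hand side of the system -/

noncomputable section

namespace ModTrap
open MeasureTheory Filter

variable {n κ p : ℕ} {δ : ℝ} {s : E n → ℝ}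

theorem IsAdmissible.exists_isRapidlyDecaying {φ : E n → ℝ} (hφ : IsAdmissible n κ p δ φ) :
    ∃ N : ℕ, 2 * (p : ℝ) - κ + 2 + δ < N ∧ n < N ∧ IsRapidlyDecaying N φ := by
  rcases hφ with ⟨N, hN, hφ, hsupp⟩ | ⟨ψ, rfl⟩
  · rw [max_lt_iff] at hN
    exact ⟨N, hN.1, by exact_mod_cast hN.2, isRapidlyDecaying_of_hasCompactSupport hφ hsupp⟩
  · obtain ⟨N, hN⟩ := exists_nat_gt (max (2 * (p : ℝ) - κ + 2 + δ) n)
    rw [max_lt_iff] at hN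
    exact ⟨N, hN.1, by exact_mod_cast hN.2, ψ.isRapidlyDecaying N⟩

theorem IsKernel.nontrivial (hs : IsKernel n κ δ s) : Nontrivial (E n) := by
  have : Nonempty (Fin n) := ⟨⟨0, hs.dim_pos⟩⟩
  infer_instance

/-- The error of the punctured trapezoidal rule for `f s`, where `f` is a rapidly decaying symbol
of order `a`. -/
theorem IsKernel.exists_error_bound (hs : IsKernel n κ δ s) {m : ℕ} (hm : n < m) {a : ℝ}
    (ha : 0 < a + δ) (ham : a + δ < m) :
    ∃ C, 0 ≤ C ∧ ∀ (f : E n → ℝ) (B B' : ℝ), IsSymbol m a B f → IsSymbol m (-δ - 1) B' f →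
      Integrable (fun x => f x * s x) ∧ ∀ h : ℝ, 0 < h →
      (Summable fun β : {β : Fin n → ℤ // β ≠ 0} => f (gridPoint h β.1) * s (gridPoint h β.1)) ∧
      |puncturedTrapezoidal h (fun x => f x * s x) - ∫ x, f x * s x| ≤ C * B * h ^ (a + δ) := by
  have := hs.nontrivial
  obtain ⟨C, hC, H⟩ := exists_forall_abs_puncturedTrapezoidal_sub_integral_le hs.dim_pos hm ha ham
  obtain ⟨Bs, hBs⟩ := hs.exists_isSymbol m
  have hBs0 := hBs.nonneg
  refine ⟨C * (2 ^ m * Bs), by positivity, fun f B B' hf hf' => ?_⟩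
  have h1 : IsSymbol m (a + δ - n) (2 ^ m * B * Bs) fun x => f x * s x := by
    have := hf.mul hBs
    rwa [← add_sub_assoc] at this
  have h2 : IsSymbol m (-(n : ℝ) - 1) (2 ^ m * B' * Bs) fun x => f x * s x := by
    have := hf'.mul hBs
    -- The decay order `-δ - 1` of `f` is chosen so that multiplication by the kernel produces
    -- exactly the order `-n - 1` required for summation.
    rwa [show -δ - 1 + (δ - n) = -(n : ℝ) - 1 by ring] at this
  obtain ⟨hi, hb⟩ := H _ _ _ h1 h2
  refine ⟨hi, fun h hh => ⟨(hb h hh).1, (hb h hh).2.trans (le_of_eq (by ring))⟩⟩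

section Window

variable {g : 𝓢(E n, ℝ)} {M : ℕ}

theorem iteratedFDeriv_sub_one_eq_zero (hg0 : g 0 = 1) (hg : PartialsVanish g M) {j : ℕ}
    (hj : j ≤ M) : iteratedFDeriv ℝ j (fun x => g x - 1) 0 = 0 := by
  rcases Nat.eq_zero_or_pos j with rfl | hj0
  · rw [← norm_eq_zero, norm_iteratedFDeriv_zero]
    simp [hg0]
  · have h1 : iteratedFDeriv ℝ j (fun x => g x - 1) 0 =
        iteratedFDeriv ℝ j g 0 - iteratedFDeriv ℝ j (fun _ : E n => (1 : ℝ)) 0 :=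
      iteratedFDeriv_sub_apply (g.smooth j).contDiffAt contDiffAt_const
    rw [h1, iteratedFDeriv_const_of_ne hj0.ne', iteratedFDeriv_eq_zero_of_partials hg hj0 hj]
    simp

/-- Flatness of `g - 1` gives the order `M + 1` near the origin. At infinity `g - 1` does not decay,
but it is a symbol of order zero, which is enough. -/
theorem exists_isSymbol_sub_one (hg0 : g 0 = 1) (hg : PartialsVanish g M) {m : ℕ}
    (hm : M + 1 ≤ m) : ∃ B, IsSymbol m (M + 1) B fun x => g x - 1 := by
  obtain ⟨B, hB⟩ := (g.isRapidlyDecaying m).exists_isSymbol le_rfl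
  exact exists_isSymbol_of_vanishing (hB.sub (isSymbol_const m 1))
    ((g.smooth m).sub contDiff_const) (by positivity) hm
    fun j hj => iteratedFDeriv_sub_one_eq_zero hg0 hg hj

theorem exists_abs_sub_one_le (hg0 : g 0 = 1) (hg : PartialsVanish g M) :
    ∃ B, 0 ≤ B ∧ ∀ x, |g x - 1| ≤ B * ‖x‖ ^ ((M : ℝ) + 1) := by
  obtain ⟨B, hB⟩ := exists_isSymbol_sub_one hg0 hg le_rfl
  refine ⟨|B|, abs_nonneg B, fun x => ?_⟩
  by_cases hx : x = 0
  · subst hx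
    rw [hg0, sub_self, abs_zero]
    positivity
  · refine (hB.norm_le hx).trans ?_
    gcongr
    exact le_abs_self B

end Window

/-- The renormalized right-hand side of the system converges at the rate `h ^ (M + 1)`. -/
theorem IsKernel.exists_rhs_limit (hs : IsKernel n κ δ s) {g : 𝓢(E n, ℝ)} {M : ℕ}
    (hg0 : g 0 = 1) (hg : PartialsVanish g M) (k : Fin n → ℕ) :
    ∃ L C : ℝ, ∀ h > 0, |1 / h ^ ((∑ j, k j : ℕ) + δ) *
        ((∫ x, g x * monomial k x * s x) -
          puncturedTrapezoidal h fun x => g x * monomial k x * s x) - L| ≤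
      C * h ^ ((M : ℝ) + 1) := by
  have := hs.nontrivial
  have hδ := hs.delta_pos
  set d : ℕ := ∑ j, k j with hd
  set q : ℝ := (M : ℝ) + 1 with hq
  have hq0 : 0 < q := by positivity
  have hd0 : (0 : ℝ) ≤ d := Nat.cast_nonneg d
  obtain ⟨m, hm⟩ := exists_nat_gt (max (max (n : ℝ) (q + d + δ)) q)
  rw [max_lt_iff, max_lt_iff] at hm
  obtain ⟨⟨hmn, hmd⟩, hmq⟩ := hm
  have hMm : M + 1 ≤ m := by rw [hq] at hmq; exact_mod_cast hmq.le
  obtain ⟨Bk, hBk⟩ := exists_isSymbol_monomial m k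
  rw [← hd] at hBk
  have hBk0 := hBk.nonneg
  obtain ⟨B, hB⟩ := exists_isSymbol_sub_one hg0 hg hMm
  rw [← hq] at hB
  obtain ⟨B₁, hB₁⟩ := (g.isRapidlyDecaying m).exists_isSymbol (a := -δ - 1 - d) (by linarith)
  obtain ⟨B₂, hB₂⟩ := (g.isRapidlyDecaying m).exists_isSymbol (a := (0 : ℝ)) le_rfl
  obtain ⟨C, hC, H⟩ := hs.exists_error_bound (m := m) (by exact_mod_cast hmn) (a := q + d)
    (by linarith) hmd
  obtain ⟨C', hC', H'⟩ := hs.exists_error_bound (m := m) (by exact_mod_cast hmn) (a := (d : ℝ))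
    (by linarith) (by linarith)
  let G : ℝ → E n → ℝ := fun h x => g (h • x) * monomial k x
  have hdec : ∀ h > 0, ∃ B', IsSymbol m (-δ - 1) B' (G h) := fun h hh =>
    ⟨_, by simpa only [sub_add_cancel] using (hB₁.comp_smul hh).mul hBk⟩
  have hG : ∀ h > 0, Integrable (fun x => G h x * s x) ∧
      Summable fun β : {β : Fin n → ℤ // β ≠ 0} =>
        G h (gridPoint 1 β.1) * s (gridPoint 1 β.1) := fun h hh => by
    obtain ⟨B', hB'⟩ := hdec h hh
    have h0 := (hB₂.comp_smul hh).mul hBk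
    rw [zero_add] at h0
    obtain ⟨h1, h2⟩ := H' _ _ _ h0 hB'
    exact ⟨h1, (h2 1 one_pos).1⟩
  set e : ℝ → ℝ := fun h =>
    (∫ x, G h x * s x) - puncturedTrapezoidal 1 fun x => G h x * s x with he
  -- Homogeneity of both the monomial and the kernel moves all dependence on `h` into the window:
  -- the normalized error at mesh size `h` is the error at mesh size one for the window `g(h ·)`.
  have hscale : ∀ h > 0, 1 / h ^ ((d : ℝ) + δ) *
        ((∫ x, g x * monomial k x * s x) -
          puncturedTrapezoidal h fun x => g x * monomial k x * s x) = e h := fun h hh => by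
    have hpt : ∀ x ≠ 0, G h x * s x = (h ^ ((d : ℝ) + δ))⁻¹ *
        (h ^ n * (g (h • x) * monomial k (h • x) * s (h • x))) := fun x hx => by
      rw [monomial_smul, hs.smul hh hx, ← hd, Real.rpow_sub hh, Real.rpow_add hh,
        Real.rpow_natCast, Real.rpow_natCast]
      have h1 : 0 < h ^ δ := Real.rpow_pos_of_pos hh δ
      have h2 : 0 < h ^ n := pow_pos hh n
      have h3 : 0 < h ^ d := pow_pos hh d
      simp only [G]
      field_simp
    have h1 : ∫ x, G h x * s x = (h ^ ((d : ℝ) + δ))⁻¹ * ∫ x, g x * monomial k x * s x := by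
      have hne : ∀ᵐ x : E n, x ≠ 0 := by simp [ae_iff]
      rw [integral_congr_ae (hne.mono hpt), integral_const_mul, integral_const_mul,
        Measure.integral_comp_smul_of_nonneg volume
          (fun x => g x * monomial k x * s x) h (hR := hh.le), finrank_euclideanSpace_fin,
        smul_eq_mul, mul_inv_cancel_left₀ (pow_pos hh n).ne']
    have h2 : puncturedTrapezoidal 1 (fun x => G h x * s x) = (h ^ ((d : ℝ) + δ))⁻¹ *
        puncturedTrapezoidal h fun x => g x * monomial k x * s x := by
      rw [puncturedTrapezoidal, puncturedTrapezoidal, one_pow, one_mul, ← mul_assoc,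
        ← tsum_mul_left]
      refine tsum_congr fun β => ?_
      rw [hpt _ (gridPoint_ne_zero one_pos β.2), smul_gridPoint]
      ring
    simp only [he]
    rw [h1, h2, one_div, mul_sub]
  have hcauchy : ∀ h > 0, ∀ h' > 0,
      |e h - e h'| ≤ C * (2 ^ m * B * Bk) * (h ^ q + h' ^ q) := fun h hh h' hh' => by
    obtain ⟨i1, s1⟩ := hG h hh
    obtain ⟨i2, s2⟩ := hG h' hh'
    obtain ⟨B', hB'⟩ := hdec h hh
    obtain ⟨B'', hB''⟩ := hdec h' hh'
    -- The difference of two windows is the difference of dilates of `g - 1`, hence a symbol of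
    -- order `q` with constant `B * h ^ q + B * h' ^ q`. The monomial raises the order to `q + d`,
    -- and the bound is used at mesh size one.
    have hsym := ((hB.comp_smul hh).sub (hB.comp_smul hh')).mul hBk
    have heq : (fun x => (g (h • x) - 1 - (g (h' • x) - 1)) * monomial k x) =
        fun x => G h x - G h' x := by
      ext x; simp only [G]; ring
    rw [heq] at hsym
    obtain ⟨-, hb⟩ := H _ _ _ hsym (hB'.sub hB'')
    have hb1 := (hb 1 one_pos).2
    have hi : ∫ x, (G h x - G h' x) * s x = (∫ x, G h x * s x) - ∫ x, G h' x * s x := by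
      simp only [sub_mul]
      exact integral_sub i1 i2
    have ht : puncturedTrapezoidal 1 (fun x => (G h x - G h' x) * s x) =
        puncturedTrapezoidal 1 (fun x => G h x * s x) -
          puncturedTrapezoidal 1 fun x => G h' x * s x := by
      simp only [puncturedTrapezoidal, one_pow, one_mul, sub_mul]
      exact s1.tsum_sub s2
    rw [hi, ht, Real.one_rpow, mul_one] at hb1
    have : e h - e h' = -(puncturedTrapezoidal 1 (fun x => G h x * s x) -
          puncturedTrapezoidal 1 (fun x => G h' x * s x) -
          ((∫ x, G h x * s x) - ∫ x, G h' x * s x)) := by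
      simp only [he]; ring
    rw [this, abs_neg]
    refine hb1.trans (le_of_eq ?_)
    ring
  obtain ⟨L, hL⟩ := exists_forall_abs_sub_le_rpow hq0 hcauchy
  exact ⟨L, _, fun h hh => by rw [hscale h hh]; exact hL h hh⟩

end ModTrap
end

/-! ## Accuracy on windowed monomials -/

noncomputable section

namespace ModTrap
open MeasureTheory Filter

variable {n κ p : ℕ} {δ : ℝ} {s : E n → ℝ}

section Correction

theorem correction_add (w : EuclideanSpace ℝ (gridI n κ p)) (h : ℝ) (f f' : E n → ℝ) :
    correction n κ p δ w h (fun x => f x + f' x) =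
      correction n κ p δ w h f + correction n κ p δ w h f' := by
  simp only [correction, mul_add, Finset.sum_add_distrib]

theorem correction_const_mul (w : EuclideanSpace ℝ (gridI n κ p)) (h c : ℝ) (f : E n → ℝ) :
    correction n κ p δ w h (fun x => c * f x) = c * correction n κ p δ w h f := by
  simp only [correction, Finset.mul_sum]
  exact Finset.sum_congr rfl fun η _ => Finset.sum_congr rfl fun β _ => by ring

/-- The finitely many correction points lie at distance proportional to `h` from the origin. For `q
= 0` the convention `0 ^ 0 = 1` covers the correction point at the origin, which occurs when `κ =
0`. -/
theorem exists_abs_correction_le (w : EuclideanSpace ℝ (gridI n κ p)) {q : ℝ} :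
    ∃ C, 0 ≤ C ∧ ∀ (f : E n → ℝ) (B : ℝ), 0 ≤ B → (∀ x, |f x| ≤ B * ‖x‖ ^ q) → ∀ h > 0,
      |correction n κ p δ w h f| ≤ C * B * h ^ (q + δ) := by
  refine ⟨∑ η : gridI n κ p, |w η| * ∑ β ∈ signOrbit η.1, ‖(gridPoint 1 β : E n)‖ ^ q,
    by positivity, fun f B hB hf h hh => ?_⟩
  have hδ : 0 < h ^ δ := Real.rpow_pos_of_pos hh δ
  have hq : 0 < h ^ q := Real.rpow_pos_of_pos hh q
  rw [correction, abs_mul, abs_of_pos hδ, Real.rpow_add hh]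
  have key : |∑ η : gridI n κ p, w η * ∑ β ∈ signOrbit η.1,
      (Int.sign (oddProd κ β) : ℝ) * f (gridPoint h β)| ≤
      ∑ η : gridI n κ p, |w η| * ∑ β ∈ signOrbit η.1,
        B * h ^ q * ‖(gridPoint 1 β : E n)‖ ^ q := by
    refine (Finset.abs_sum_le_sum_abs _ _).trans (Finset.sum_le_sum fun η _ => ?_)
    rw [abs_mul]
    refine mul_le_mul_of_nonneg_left ?_ (abs_nonneg _)
    refine (Finset.abs_sum_le_sum_abs _ _).trans (Finset.sum_le_sum fun β _ => ?_)
    have hsign : |(Int.sign (oddProd κ β) : ℝ)| ≤ 1 := by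
      rcases Int.sign_trichotomy (oddProd κ β) with h | h | h <;> rw [h] <;> norm_num
    rw [abs_mul]
    calc _ ≤ 1 * |f (gridPoint h β)| := by gcongr
      _ ≤ B * ‖(gridPoint h β : E n)‖ ^ q := by rw [one_mul]; exact hf _
      _ = _ := by
        rw [norm_gridPoint hh.le, Real.mul_rpow hh.le (norm_nonneg _), mul_assoc]
  refine (mul_le_mul_of_nonneg_left key hδ.le).trans (le_of_eq ?_)
  simp only [← Finset.mul_sum]
  simp only [Finset.mul_sum, Finset.sum_mul]
  refine Finset.sum_congr rfl fun η _ => Finset.sum_congr rfl fun β _ => by ring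

end Correction

/-- `f s` is integrable and summable on all grids, and the modified trapezoidal rule integrates it
with an error of order `r` for mesh sizes up to one. -/
structure IsAccurate (n κ p : ℕ) (δ r : ℝ) (s : E n → ℝ) (w : EuclideanSpace ℝ (gridI n κ p))
    (f : E n → ℝ) : Prop where
  integrable : Integrable fun x => f x * s x
  summable : ∀ h : ℝ, 0 < h → Summable fun β : {β : Fin n → ℤ // β ≠ 0} =>
    f (gridPoint h β.1) * s (gridPoint h β.1)
  error : ∃ C, ∀ h : ℝ, 0 < h → h ≤ 1 →
    |modifiedTrapezoidal n κ p δ w h f s - ∫ x, f x * s x| ≤ C * h ^ r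

namespace IsAccurate

variable {r : ℝ} {w : EuclideanSpace ℝ (gridI n κ p)} {f f' : E n → ℝ}

theorem add (hf : IsAccurate n κ p δ r s w f) (hf' : IsAccurate n κ p δ r s w f') :
    IsAccurate n κ p δ r s w fun x => f x + f' x := by
  refine ⟨?_, fun h hh => ?_, ?_⟩
  · simp only [add_mul]
    exact hf.integrable.add hf'.integrable
  · simpa only [add_mul] using (hf.summable h hh).add (hf'.summable h hh)
  · obtain ⟨C, hC⟩ := hf.error
    obtain ⟨C', hC'⟩ := hf'.error
    refine ⟨C + C', fun h hh h1 => ?_⟩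
    have hi : ∫ x, (f x + f' x) * s x = (∫ x, f x * s x) + ∫ x, f' x * s x := by
      simp only [add_mul]
      exact integral_add hf.integrable hf'.integrable
    have ht : modifiedTrapezoidal n κ p δ w h (fun x => f x + f' x) s =
        modifiedTrapezoidal n κ p δ w h f s + modifiedTrapezoidal n κ p δ w h f' s := by
      simp only [modifiedTrapezoidal, puncturedTrapezoidal, add_mul, correction_add]
      rw [(hf.summable h hh).tsum_add (hf'.summable h hh)]
      ring
    rw [hi, ht, add_sub_add_comm, add_mul]
    exact (abs_add_le _ _).trans (add_le_add (hC h hh h1) (hC' h hh h1))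

theorem const_mul (hf : IsAccurate n κ p δ r s w f) (c : ℝ) :
    IsAccurate n κ p δ r s w fun x => c * f x := by
  refine ⟨?_, fun h hh => ?_, ?_⟩
  · simpa only [mul_assoc] using hf.integrable.const_mul c
  · simpa only [mul_assoc] using (hf.summable h hh).mul_left c
  · obtain ⟨C, hC⟩ := hf.error
    refine ⟨|c| * C, fun h hh h1 => ?_⟩
    have hi : ∫ x, c * f x * s x = c * ∫ x, f x * s x := by
      simp only [mul_assoc]
      exact integral_const_mul c _
    have ht : modifiedTrapezoidal n κ p δ w h (fun x => c * f x) s =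
        c * modifiedTrapezoidal n κ p δ w h f s := by
      simp only [modifiedTrapezoidal, puncturedTrapezoidal, mul_assoc, correction_const_mul,
        tsum_mul_left]
      ring
    rw [hi, ht, ← mul_sub, abs_mul, mul_assoc]
    exact mul_le_mul_of_nonneg_left (hC h hh h1) (abs_nonneg c)

theorem zero : IsAccurate n κ p δ r s w fun _ => 0 :=
  ⟨by simp, fun h _ => by simp,
    0, fun h _ _ => by simp [modifiedTrapezoidal, puncturedTrapezoidal, correction]⟩

theorem sum {ι : Type*} (t : Finset ι) {f : ι → E n → ℝ}
    (hf : ∀ i ∈ t, IsAccurate n κ p δ r s w (f i)) :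
    IsAccurate n κ p δ r s w fun x => ∑ i ∈ t, f i x := by
  classical
  induction t using Finset.induction_on with
  | empty => simpa using zero
  | insert a t ha ih =>
    simp only [Finset.sum_insert ha]
    exact (hf a (Finset.mem_insert_self a t)).add
      (ih fun i hi => hf i (Finset.mem_insert_of_mem hi))

end IsAccurate

theorem rhs_eq {g : E n → ℝ} (hκ : κ ≤ n) (h : ℝ) (ξ : gridI n κ p) :
    rhs n κ p δ g s h ξ = 1 / h ^ ((∑ j, expo κ ξ.1 j : ℕ) + δ) *
      ((∫ x, g x * monomial (expo κ ξ.1) x * s x) -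
        puncturedTrapezoidal h fun x => g x * monomial (expo κ ξ.1) x * s x) := by
  have : testIntegrand κ g s ξ.1 = fun x => g x * monomial (expo κ ξ.1) x * s x := by
    ext x; rw [testIntegrand]; ring
  rw [rhs, this, sum_expo hκ ξ.2]

theorem cast_order (hp : κ ≤ 2 * p) :
    ((2 * p - κ + 1 : ℕ) : ℝ) + 1 = 2 * (p : ℝ) - κ + 2 := by
  push_cast [Nat.cast_sub hp]; ring

/-- A Schwartz function times a monomial times the kernel can be integrated and summed. -/
theorem IsKernel.integrable_summable_monomial (hs : IsKernel n κ δ s) (g : 𝓢(E n, ℝ))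
    (k : Fin n → ℕ) : Integrable (fun x => g x * monomial k x * s x) ∧
      ∀ h : ℝ, 0 < h → Summable fun β : {β : Fin n → ℤ // β ≠ 0} =>
        g (gridPoint h β.1) * monomial k (gridPoint h β.1) * s (gridPoint h β.1) := by
  have := hs.nontrivial
  have hδ := hs.delta_pos
  set d : ℕ := ∑ j, k j with hd
  have hd0 : (0 : ℝ) ≤ d := Nat.cast_nonneg d
  obtain ⟨m, hm⟩ := exists_nat_gt (max (n : ℝ) (d + δ))
  rw [max_lt_iff] at hm
  obtain ⟨C, -, H⟩ := hs.exists_error_bound (m := m) (by exact_mod_cast hm.1) (a := (d : ℝ))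
    (by linarith) hm.2
  obtain ⟨Bk, hBk⟩ := exists_isSymbol_monomial m k
  rw [← hd] at hBk
  obtain ⟨B₁, hB₁⟩ := (g.isRapidlyDecaying m).exists_isSymbol (a := -δ - 1 - d) (by linarith)
  obtain ⟨B₂, hB₂⟩ := (g.isRapidlyDecaying m).exists_isSymbol (a := (0 : ℝ)) le_rfl
  have h1 := hB₂.mul hBk
  have h2 := hB₁.mul hBk
  rw [zero_add] at h1
  rw [sub_add_cancel] at h2
  obtain ⟨i, b⟩ := H _ _ _ h1 h2
  exact ⟨i, fun h hh => (b h hh).1⟩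

section Monomials

variable {g : 𝓢(E n, ℝ)} {w : EuclideanSpace ℝ (gridI n κ p)}

/-- With the parity of `f` opposite to that of the kernel in coordinate `j`, the product `f s` is
odd under that reflection. The integral, the punctured sum and the correction vanish separately, for
any weights. -/
theorem modifiedTrapezoidal_eq_zero_of_reflect {f : E n → ℝ} (hs : IsKernel n κ δ s) {j : Fin n}
    (hf : ∀ x, f (reflect j x) = -((if (j : ℕ) < κ then -1 else 1) * f x)) {h : ℝ} (hh : 0 < h) :
    modifiedTrapezoidal n κ p δ w h f s = 0 ∧ ∫ x, f x * s x = 0 := by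
  have hfs : ∀ x ≠ 0, f (reflect j x) * s (reflect j x) = -(f x * s x) := fun x hx => by
    have := hs.symmetry j x hx
    rw [hf x, this]
    split_ifs <;> ring
  refine ⟨?_, integral_eq_zero_of_reflect hs.dim_pos hfs⟩
  rw [modifiedTrapezoidal, puncturedTrapezoidal_eq_zero_of_reflect hfs hh, correction]
  simp [orbitSum_eq_zero_of_reflect hf]

/-- This is where the linear system comes from: on a windowed monomial of matching parity, the
correction is a power of `h` times a row of `K G(h) w`. Radial symmetry makes the window constant on
each orbit, so it factors out of the orbit sum. -/
theorem correction_monomial (hg : IsRadial g) {h : ℝ} (hh : 0 < h) (ξ : gridI n κ p) :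
    correction n κ p δ w h (fun x => g x * monomial (expo κ ξ.1) x) =
      h ^ ((∑ j, expo κ ξ.1 j : ℕ) + δ) *
        ∑ η, matK n κ p ξ η * (g (gridPoint h η.1) * w η) := by
  rw [correction, Real.rpow_add hh, Real.rpow_natCast, mul_comm (h ^ _) (h ^ δ), mul_assoc]
  congr 1
  rw [Finset.mul_sum]
  refine Finset.sum_congr rfl fun η _ => ?_
  rw [matK, Matrix.of_apply, Finset.sum_mul, Finset.mul_sum, Finset.mul_sum]
  refine Finset.sum_congr rfl fun β hβ => ?_
  rw [monomial_gridPoint, hg _ _ (norm_gridPoint_of_mem_signOrbit hβ h)]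
  ring

/-- For matching parity the error is a component of `K G(h) w - c(h)` up to scaling, and `K w` is
the limit of `c(h)`. What remains is `K (G(h) - 1) w`, small by flatness of the window, and the
known convergence error of `c(h)`. -/
theorem isAccurate_monomial (hs : IsKernel n κ δ s) (hp : κ ≤ 2 * p) (hg : IsRadial g)
    (hg0 : g 0 = 1) (hgM : PartialsVanish g (2 * p - κ + 1))
    {c : gridI n κ p → ℝ} {C : gridI n κ p → ℝ}
    (hc : ∀ ξ, ∀ h > 0, |rhs n κ p δ g s h ξ - c ξ| ≤ C ξ * h ^ (2 * (p : ℝ) - κ + 2))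
    (hw : matK n κ p *ᵥ w.ofLp = c) {k : Fin n → ℕ} (hk : ∑ j, k j ≤ 2 * p - κ + 1) :
    IsAccurate n κ p δ (2 * (p : ℝ) - κ + 2 + δ) s w fun x => g x * monomial k x := by
  obtain ⟨hi, hsum⟩ := hs.integrable_summable_monomial g k
  refine ⟨hi, hsum, ?_⟩
  have hgr : ∀ j x, g (reflect j x) = g x := fun j x => hg _ _ (norm_reflect j x)
  by_cases hmatch : (∀ j : Fin n, (j : ℕ) < κ → Odd (k j)) ∧
      ∀ j : Fin n, ¬ (j : ℕ) < κ → Even (k j)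
  · obtain ⟨ξ, hξ, rfl⟩ := exists_expo_eq hs.kappa_le hp hk hmatch.1 hmatch.2
    obtain ⟨ξ, rfl⟩ : ∃ ξ' : gridI n κ p, ξ'.1 = ξ := ⟨⟨ξ, hξ⟩, rfl⟩
    obtain ⟨B, hB, hgB⟩ := exists_abs_sub_one_le hg0 hgM
    rw [cast_order hp] at hgB
    set q : ℝ := 2 * (p : ℝ) - κ + 2 with hq
    set d : ℕ := ∑ j, expo κ ξ.1 j with hd
    refine ⟨∑ η, |matK n κ p ξ η| * (B * ‖(gridPoint 1 η.1 : E n)‖ ^ q * |w η|) + C ξ,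
      fun h hh h1 => ?_⟩
    have hpow : 0 < h ^ ((d : ℝ) + δ) := Real.rpow_pos_of_pos hh _
    have hrhs := rhs_eq (δ := δ) (s := s) (g := g) hs.kappa_le h ξ
    rw [← hd] at hrhs
    have hcξ : ∑ η, matK n κ p ξ η * w η = c ξ := congr_fun hw ξ
    have herr : modifiedTrapezoidal n κ p δ w h (fun x => g x * monomial (expo κ ξ.1) x) s -
        ∫ x, g x * monomial (expo κ ξ.1) x * s x = h ^ ((d : ℝ) + δ) *
          (∑ η, matK n κ p ξ η * ((g (gridPoint h η.1) - 1) * w η) -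
            (rhs n κ p δ g s h ξ - c ξ)) := by
      have h3 : ∑ η, matK n κ p ξ η * ((g (gridPoint h η.1) - 1) * w η) =
          ∑ η, matK n κ p ξ η * (g (gridPoint h η.1) * w η) - c ξ := by
        rw [← hcξ, ← Finset.sum_sub_distrib]
        exact Finset.sum_congr rfl fun η _ => by ring
      rw [modifiedTrapezoidal, correction_monomial hg hh, ← hd, h3, hrhs]
      field_simp
      ring
    rw [herr, abs_mul, abs_of_pos hpow, Real.rpow_add hh q]
    -- The extra power `h ^ d` is discarded, which requires `h ≤ 1`; this is why accuracy is first
    -- proved only for such mesh sizes.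
    have hhd : h ^ ((d : ℝ) + δ) ≤ h ^ δ := by
      refine Real.rpow_le_rpow_of_exponent_ge hh h1 ?_
      linarith [(Nat.cast_nonneg d : (0 : ℝ) ≤ d)]
    have hbr : |∑ η, matK n κ p ξ η * ((g (gridPoint h η.1) - 1) * w η) -
        (rhs n κ p δ g s h ξ - c ξ)| ≤
        (∑ η, |matK n κ p ξ η| * (B * ‖(gridPoint 1 η.1 : E n)‖ ^ q * |w η|) + C ξ) * h ^ q := by
      refine (abs_sub _ _).trans ?_
      rw [add_mul, Finset.sum_mul]
      refine add_le_add ((Finset.abs_sum_le_sum_abs _ _).trans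
        (Finset.sum_le_sum fun η _ => ?_)) (hc ξ h hh)
      have hgη := hgB (gridPoint h η.1)
      rw [norm_gridPoint hh.le, Real.mul_rpow hh.le (norm_nonneg _)] at hgη
      rw [abs_mul, abs_mul]
      calc _ ≤ |matK n κ p ξ η| *
            (B * (h ^ q * ‖(gridPoint 1 η.1 : E n)‖ ^ q) * |w η|) := by gcongr
        _ = _ := by ring
    calc _ ≤ h ^ δ * _ := mul_le_mul hhd hbr (abs_nonneg _) (Real.rpow_nonneg hh.le _)
      _ = _ := by ring
  · refine ⟨0, fun h hh _ => ?_⟩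
    -- A parity mismatch in a single coordinate suffices, since `g` is invariant under reflections
    -- and the monomial then has the wrong sign.
    have hex : ∃ j : Fin n, ∀ x, g (reflect j x) * monomial k (reflect j x) =
        -((if (j : ℕ) < κ then -1 else 1) * (g x * monomial k x)) := by
      rw [not_and_or] at hmatch
      rcases hmatch with hm | hm <;> push Not at hm <;> obtain ⟨j, hj, hpar⟩ := hm <;>
        refine ⟨j, fun x => ?_⟩ <;> rw [hgr, monomial_reflect]
      · rw [if_pos hj, (Nat.not_odd_iff_even.1 hpar).neg_one_pow]; ring
      · rw [if_neg (not_lt.2 hj), (Nat.not_even_iff_odd.1 hpar).neg_one_pow]; ring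
    obtain ⟨j, hj⟩ := hex
    obtain ⟨h1, h2⟩ := modifiedTrapezoidal_eq_zero_of_reflect (w := w)
      (f := fun x => g x * monomial k x) hs hj hh
    rw [h1, h2]
    simp

end Monomials

end ModTrap
end

/-! ## The remainder and the linear system -/

noncomputable section

namespace ModTrap
open MeasureTheory Filter

variable {n κ p : ℕ} {δ : ℝ} {s : E n → ℝ}

section Remainder

variable {g : 𝓢(E n, ℝ)} {M : ℕ}

/-- With `P` the Taylor polynomial, `φ - g P = (φ - P) - (g - 1) P`. The first term vanishes to
order `M` by Taylor's formula, and the second by the Leibniz rule, because every derivative of `g -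
1` that appears is zero. -/
theorem iteratedFDeriv_sub_windowed_taylor (hg0 : g 0 = 1) (hg : PartialsVanish g M)
    {φ : E n → ℝ} (hφ : ContDiff ℝ M φ) {l : ℕ} (hl : l ≤ M) :
    iteratedFDeriv ℝ l
      (fun x => φ x - ∑ j ∈ Finset.range (M + 1), g x * taylorPart φ j x) 0 = 0 := by
  have hlM : (l : ℕ∞ω) ≤ M := by exact_mod_cast hl
  set P : E n → ℝ := fun x => ∑ j ∈ Finset.range (M + 1), taylorPart φ j x with hP
  have hPc : ContDiff ℝ M P := ContDiff.sum fun j _ => contDiff_taylorPart φ j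
  have hgc : ContDiff ℝ M fun x => g x - 1 := (g.smooth M).sub contDiff_const
  have hsplit : (fun x => φ x - ∑ j ∈ Finset.range (M + 1), g x * taylorPart φ j x) =
      (fun x => φ x - P x) - fun x => (g x - 1) * P x := by
    ext x
    simp only [hP, Pi.sub_apply, ← Finset.mul_sum]
    ring
  have hprod : iteratedFDeriv ℝ l (fun x => (g x - 1) * P x) 0 = 0 := by
    rw [← norm_le_zero_iff]
    refine (norm_iteratedFDeriv_mul_le hgc hPc 0 hlM).trans (le_of_eq ?_)
    refine Finset.sum_eq_zero fun i hi => ?_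
    have hil : i ≤ M := (Nat.lt_succ_iff.1 (Finset.mem_range.1 hi)).trans hl
    rw [iteratedFDeriv_sub_one_eq_zero hg0 hg hil]
    simp
  rw [hsplit, iteratedFDeriv_sub_apply ((hφ.sub hPc).of_le hlM).contDiffAt
    ((hgc.mul hPc).of_le hlM).contDiffAt, hprod, iteratedFDeriv_sub_taylor hφ hl, sub_zero]

theorem exists_isSymbol_taylorPart (m : ℕ) (φ : E n → ℝ) (j : ℕ) :
    ∃ B, IsSymbol m (j : ℝ) B (taylorPart φ j) :=
  exists_isSymbol_of_homogeneous m (contDiff_taylorPart φ j).contDiffOn fun t _ x _ => by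
    rw [taylorPart_smul, Real.rpow_natCast]

theorem exists_isSymbol_sum {V : Type*} [NormedAddCommGroup V] [NormedSpace ℝ V] {m : ℕ} {a : ℝ}
    {ι : Type*} (t : Finset ι) {f : ι → V → ℝ} (hf : ∀ i, ∃ B, IsSymbol m a B (f i)) :
    ∃ B, IsSymbol m a B fun x => ∑ i ∈ t, f i x := by
  classical
  induction t using Finset.induction_on with
  | empty =>
    by_cases h : Nonempty ι
    · obtain ⟨B, hB⟩ := hf h.some
      exact ⟨_, by simpa using hB.const_mul 0⟩
    · refine ⟨0, by simpa using contDiffOn_const, fun j _ x _ => ?_⟩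
      simp only [Finset.sum_empty, zero_mul]
      rw [iteratedFDeriv_fun_zero]
      simp
  | insert i t hi ih =>
    obtain ⟨B, hB⟩ := hf i
    obtain ⟨B', hB'⟩ := ih
    exact ⟨_, by simpa only [Finset.sum_insert hi] using hB.add hB'⟩

theorem exists_isSymbol_windowed_remainder [Nontrivial (E n)] {m : ℕ} {φ : E n → ℝ}
    (hφ : IsRapidlyDecaying m φ) {a : ℝ} (ha : a ≤ 0) :
    ∃ B, IsSymbol m a B
      fun x => φ x - ∑ j ∈ Finset.range (M + 1), g x * taylorPart φ j x := by
  obtain ⟨B, hB⟩ := hφ.exists_isSymbol ha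
  obtain ⟨B', hB'⟩ := exists_isSymbol_sum (m := m) (a := a) (Finset.range (M + 1))
    (f := fun j x => g x * taylorPart φ j x) fun j => by
      -- The window is given order `a - j` to offset the growth of the degree-`j` Taylor part.
      obtain ⟨B₁, hB₁⟩ := (g.isRapidlyDecaying m).exists_isSymbol (a := a - j)
        (by linarith [(Nat.cast_nonneg j : (0 : ℝ) ≤ j)])
      obtain ⟨B₂, hB₂⟩ := exists_isSymbol_taylorPart m φ j
      exact ⟨_, by simpa only [sub_add_cancel] using hB₁.mul hB₂⟩
  exact ⟨_, hB.sub hB'⟩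

/-- The remainder is a symbol of order `M + 1`, so the punctured rule is already accurate enough,
and the values at the correction points are `O(h ^ (M + 1))`. No condition on the weights is needed.
-/
theorem isAccurate_windowed_remainder (hs : IsKernel n κ δ s) (hg0 : g 0 = 1)
    (hg : PartialsVanish g M) (w : EuclideanSpace ℝ (gridI n κ p)) {m : ℕ} (hnm : n < m)
    (hm : (M : ℝ) + 1 + δ < m) {φ : E n → ℝ} (hφ : IsRapidlyDecaying m φ) :
    IsAccurate n κ p δ (M + 1 + δ) s w
      fun x => φ x - ∑ j ∈ Finset.range (M + 1), g x * taylorPart φ j x := by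
  have := hs.nontrivial
  have hδ := hs.delta_pos
  have hMm : M + 1 ≤ m := by
    have : ((M + 1 : ℕ) : ℝ) < m := by push_cast; linarith
    exact_mod_cast this.le
  have hφM : ContDiff ℝ M φ := hφ.contDiff.of_le (by exact_mod_cast (Nat.le_succ M).trans hMm)
  have hvan := fun j hj => iteratedFDeriv_sub_windowed_taylor hg0 hg hφM (l := j) hj
  obtain ⟨B', hB'⟩ := exists_isSymbol_windowed_remainder (g := g) (M := M) hφ
    (a := -δ - 1) (by linarith)
  obtain ⟨B₀, hB₀⟩ := exists_isSymbol_windowed_remainder (g := g) (M := M) hφ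
    (a := (0 : ℝ)) le_rfl
  set ψ : E n → ℝ := fun x => φ x - ∑ j ∈ Finset.range (M + 1), g x * taylorPart φ j x with hψ
  have hψc : ContDiff ℝ m ψ := hφ.contDiff.sub
    (ContDiff.sum fun j _ => (g.smooth m).mul (contDiff_taylorPart φ j))
  obtain ⟨B, hB⟩ := exists_isSymbol_of_vanishing hB₀ hψc (by positivity) hMm hvan
  have hB0 := hB.nonneg
  obtain ⟨C, hC, H⟩ := hs.exists_error_bound hnm (a := (M : ℝ) + 1) (by positivity) hm
  obtain ⟨hi, hb⟩ := H ψ B B' hB hB'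
  refine ⟨hi, fun h hh => (hb h hh).1, ?_⟩
  have hψ0 : ψ 0 = 0 := by
    have := hvan 0 (Nat.zero_le _)
    rw [← norm_eq_zero, norm_iteratedFDeriv_zero, norm_eq_zero] at this
    exact this
  have hψB : ∀ x, |ψ x| ≤ B * ‖x‖ ^ ((M : ℝ) + 1) := fun x => by
    by_cases hx : x = 0
    · subst hx
      rw [hψ0, abs_zero]
      positivity
    · exact hB.norm_le hx
  obtain ⟨C', -, hC'⟩ := exists_abs_correction_le (δ := δ) w (q := (M : ℝ) + 1)
  refine ⟨C * B + C' * B, fun h hh _ => ?_⟩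
  rw [modifiedTrapezoidal, add_sub_right_comm, add_mul]
  exact (abs_add_le _ _).trans (add_le_add (hb h hh).2 (hC' ψ B hB0 hψB h hh))

end Remainder

section System

variable {g : 𝓢(E n, ℝ)}

theorem mulVec_matG (h : ℝ) (w : gridI n κ p → ℝ) :
    matG n κ p g h *ᵥ w = fun η => g (gridPoint h η.1) * w η := by
  ext η
  rw [matG, Matrix.mulVec_diagonal]

theorem eventually_half_lt (hg0 : g 0 = 1) :
    ∀ᶠ h in 𝓝[>] (0 : ℝ), ∀ η : gridI n κ p, 1 / 2 < g (gridPoint h η.1) := by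
  refine eventually_all.2 fun η => ?_
  have hc : Continuous fun h : ℝ => g (gridPoint h η.1) := by
    have : (fun h : ℝ => g (gridPoint h η.1)) = fun h => g (h • (gridPoint 1 η.1 : E n)) := by
      ext h; rw [smul_gridPoint]
    rw [this]
    exact g.continuous.comp (continuous_id.smul continuous_const)
  have h0 : g (gridPoint 0 η.1) = 1 := by
    rw [← smul_gridPoint, zero_smul, hg0]
  have ht : Tendsto (fun h : ℝ => g (gridPoint h η.1)) (𝓝[>] 0) (𝓝 1) := by
    have := hc.tendsto 0
    rw [h0] at this
    exact this.mono_left nhdsWithin_le_nhds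
  exact ht.eventually_const_lt (by norm_num)

theorem existsUnique_solvesSystem {h : ℝ} (hh : ∀ η : gridI n κ p, 1 / 2 < g (gridPoint h η.1)) :
    ∃! w, SolvesSystem n κ p δ g s h w := by
  have hG : IsUnit (matG n κ p g h) := by
    rw [matG, Matrix.isUnit_diagonal, Pi.isUnit_iff]
    exact fun η => (one_half_pos.trans (hh η)).ne'.isUnit
  have hKG : IsUnit (matK n κ p * matG n κ p g h) := isUnit_matK.mul hG
  have hbij : Function.Bijective (matK n κ p * matG n κ p g h).mulVec :=
    ⟨Matrix.mulVec_injective_iff_isUnit.2 hKG, Matrix.mulVec_surjective_iff_isUnit.2 hKG⟩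
  obtain ⟨w, hw, huniq⟩ := hbij.existsUnique (rhs n κ p δ g s h)
  exact ⟨WithLp.toLp 2 w, hw, fun w' hw' => by
    rw [← huniq w'.ofLp hw']⟩

theorem norm_le_sum_abs {ι : Type*} [Fintype ι] (x : EuclideanSpace ℝ ι) : ‖x‖ ≤ ∑ i, |x i| := by
  classical
  have hx : x = ∑ i, x i • (EuclideanSpace.single i (1 : ℝ) : EuclideanSpace ℝ ι) := by
    ext k; simp [Pi.single_apply]
  conv_lhs => rw [hx]
  refine (norm_sum_le _ _).trans (le_of_eq (Finset.sum_congr rfl fun i _ => ?_))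
  rw [norm_smul, PiLp.norm_single, norm_one, mul_one, Real.norm_eq_abs]

/-- Subtracting the limiting system gives `G(h) (u(h) - w) = K⁻¹ (c(h) - c) - (G(h) - 1) w`. Both
terms on the right are `O(h ^ q)`, and for small `h` the diagonal entries of `G(h)` exceed `1 / 2`,
so they can be divided out. -/
theorem isBigO_sub_of_solvesSystem {q : ℝ} (hg0 : g 0 = 1) {B : ℝ}
    (hgB : ∀ x, |g x - 1| ≤ B * ‖x‖ ^ q) {c C : gridI n κ p → ℝ}
    (hc : ∀ ξ, ∀ h > 0, |rhs n κ p δ g s h ξ - c ξ| ≤ C ξ * h ^ q)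
    {w : EuclideanSpace ℝ (gridI n κ p)} (hw : matK n κ p *ᵥ w.ofLp = c)
    {u : ℝ → EuclideanSpace ℝ (gridI n κ p)}
    (hu : ∀ᶠ h in 𝓝[>] (0 : ℝ), SolvesSystem n κ p δ g s h (u h)) :
    (fun h => ‖u h - w‖) =O[𝓝[>] (0 : ℝ)] fun h => h ^ q := by
  have hdet : IsUnit (matK n κ p).det := (Matrix.isUnit_iff_isUnit_det _).1 isUnit_matK
  have hinv : ∀ v : gridI n κ p → ℝ, (matK n κ p)⁻¹ *ᵥ (matK n κ p *ᵥ v) = v := fun v => by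
    rw [Matrix.mulVec_mulVec, Matrix.nonsing_inv_mul _ hdet, Matrix.one_mulVec]
  set D : gridI n κ p → ℝ := fun η => ∑ ξ, |(matK n κ p)⁻¹ η ξ| * C ξ +
    B * ‖(gridPoint 1 η.1 : E n)‖ ^ q * |w η| with hD
  refine Asymptotics.IsBigO.of_bound (∑ η, 2 * D η) ?_
  filter_upwards [hu, eventually_half_lt (κ := κ) (p := p) hg0, self_mem_nhdsWithin]
    with h hsol hhalf hh
  have hh : 0 < h := hh
  have hq : 0 < h ^ q := Real.rpow_pos_of_pos hh q
  have hGu : (fun η => g (gridPoint h η.1) * u h η) =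
      (matK n κ p)⁻¹ *ᵥ rhs n κ p δ g s h := by
    rw [← show _ = rhs n κ p δ g s h from hsol, ← Matrix.mulVec_mulVec, hinv, mulVec_matG]
  have hwc : w.ofLp = (matK n κ p)⁻¹ *ᵥ c := by rw [← hw, hinv]
  rw [norm_norm, Real.norm_eq_abs, abs_of_pos hq, Finset.sum_mul]
  refine (norm_le_sum_abs _).trans (Finset.sum_le_sum fun η _ => ?_)
  have h1 : g (gridPoint h η.1) * (u h η - w η) =
      ∑ ξ, (matK n κ p)⁻¹ η ξ * (rhs n κ p δ g s h ξ - c ξ) -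
        (g (gridPoint h η.1) - 1) * w η := by
    have e1 : g (gridPoint h η.1) * u h η = ∑ ξ, (matK n κ p)⁻¹ η ξ * rhs n κ p δ g s h ξ :=
      congr_fun hGu η
    have e2 : w η = ∑ ξ, (matK n κ p)⁻¹ η ξ * c ξ := congr_fun hwc η
    simp only [mul_sub, Finset.sum_sub_distrib]
    rw [← e1, ← e2]
    ring
  have h2 : |g (gridPoint h η.1) * (u h η - w η)| ≤ D η * h ^ q := by
    rw [h1, hD]
    refine (abs_sub _ _).trans ?_
    rw [add_mul, Finset.sum_mul]
    refine add_le_add ((Finset.abs_sum_le_sum_abs _ _).trans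
      (Finset.sum_le_sum fun ξ _ => ?_)) ?_
    · rw [abs_mul, mul_assoc]
      exact mul_le_mul_of_nonneg_left (hc ξ h hh) (abs_nonneg _)
    · have hgη := hgB (gridPoint h η.1)
      rw [norm_gridPoint hh.le, Real.mul_rpow hh.le (norm_nonneg _)] at hgη
      rw [abs_mul]
      calc _ ≤ B * (h ^ q * ‖(gridPoint 1 η.1 : E n)‖ ^ q) * |w η| := by gcongr
        _ = _ := by ring
  rw [abs_mul, abs_of_pos (by linarith [hhalf η])] at h2
  have h3 : 1 / 2 * |u h η - w η| ≤ g (gridPoint h η.1) * |u h η - w η| := by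
    gcongr
    exact (hhalf η).le
  have h4 : |(u h - w) η| = |u h η - w η| := rfl
  rw [h4]
  linarith

end System

end ModTrap
end

/-! ### Assembly of the main theorem -/

open ModTrap MeasureTheory Filter in
theorem theorem3p1 (n κ p : ℕ) (hp : κ ≤ 2 * p) (δ : ℝ) (s : ModTrap.E n → ℝ)
    (hs : ModTrap.IsKernel n κ δ s) (g : 𝓢(ModTrap.E n, ℝ)) (hg_radial : ModTrap.IsRadial g)
    (hg_zero : g 0 = 1) (hg_deriv : ModTrap.PartialsVanish g (2 * p - κ + 1)) :
    -- the integrals and sums on the right-hand side of the system converge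
    (∀ ξ ∈ ModTrap.gridI n κ p,
      MeasureTheory.Integrable (ModTrap.testIntegrand κ g s ξ) ∧
      ∀ h : ℝ, 0 < h → Summable fun β : {β : Fin n → ℤ // β ≠ 0} =>
        ModTrap.testIntegrand κ g s ξ (ModTrap.gridPoint h β.1)) ∧
    -- the system has exactly one solution for all small mesh sizes
    (∀ᶠ h in 𝓝[>] (0 : ℝ), ∃! w, ModTrap.SolvesSystem n κ p δ g s h w) ∧
    ∃ wbar : EuclideanSpace ℝ (ModTrap.gridI n κ p),
      -- the solutions converge to `wbar` at the stated rate
      (∀ u : ℝ → EuclideanSpace ℝ (ModTrap.gridI n κ p),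
        (∀ᶠ h in 𝓝[>] (0 : ℝ), ModTrap.SolvesSystem n κ p δ g s h (u h)) →
        Filter.Tendsto u (𝓝[>] 0) (𝓝 wbar) ∧
        (fun h => ‖u h - wbar‖) =O[𝓝[>] (0 : ℝ)]
          fun h => h ^ (2 * (p : ℝ) - (κ : ℝ) + 2)) ∧
      -- the modified trapezoidal rule with the weights `wbar` has the stated accuracy
      ∀ φ : ModTrap.E n → ℝ, ModTrap.IsAdmissible n κ p δ φ →
        MeasureTheory.IntegrableOn (fun x => φ x * s x) {0}ᶜ ∧
        (∀ h : ℝ, 0 < h → Summable fun β : {β : Fin n → ℤ // β ≠ 0} =>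
          φ (ModTrap.gridPoint h β.1) * s (ModTrap.gridPoint h β.1)) ∧
        ∃ C : ℝ, 0 < C ∧ ∀ h : ℝ, 0 < h →
          |ModTrap.modifiedTrapezoidal n κ p δ wbar h φ s -
              ∫ x in ({0}ᶜ : Set (ModTrap.E n)), φ x * s x| ≤
            C * h ^ (2 * (p : ℝ) - (κ : ℝ) + 2 + δ) := by
  have := hs.nontrivial
  have hδ := hs.delta_pos
  have hM := cast_order hp
  obtain ⟨B, hB0, hB⟩ := exists_abs_sub_one_le hg_zero hg_deriv
  have hlim := fun ξ : gridI n κ p => hs.exists_rhs_limit hg_zero hg_deriv (expo κ ξ.1)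
  choose c C hc using hlim
  simp only [← rhs_eq (δ := δ) (s := s) (g := g) hs.kappa_le] at hc
  have hq : 0 < 2 * (p : ℝ) - κ + 2 := by rw [← hM]; positivity
  set M : ℕ := 2 * p - κ + 1 with hMdef
  rw [hM] at hB hc
  -- As `h → 0` the matrix `G(h)` tends to the identity, so the limiting weights solve `K w = c`.
  set w : EuclideanSpace ℝ (gridI n κ p) := WithLp.toLp 2 ((matK n κ p)⁻¹ *ᵥ c) with hwdef
  have hw : matK n κ p *ᵥ w.ofLp = c := by
    rw [hwdef, Matrix.mulVec_mulVec,
      Matrix.mul_nonsing_inv _ ((Matrix.isUnit_iff_isUnit_det _).1 isUnit_matK),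
      Matrix.one_mulVec]
  refine ⟨fun ξ _ => ?_, (eventually_half_lt hg_zero).mono fun h hh =>
    existsUnique_solvesSystem hh, w, fun u hu => ?_, fun φ hφ => ?_⟩
  · have heq : testIntegrand κ g s ξ = fun x => g x * monomial (expo κ ξ) x * s x := by
      ext x; rw [testIntegrand]; ring
    rw [heq]
    exact hs.integrable_summable_monomial g _
  · have hO := isBigO_sub_of_solvesSystem hg_zero hB hc hw hu
    refine ⟨tendsto_iff_norm_sub_tendsto_zero.2 (hO.trans_tendsto ?_), hO⟩
    have := (continuous_id.tendsto (0 : ℝ)).rpow_const (p := 2 * (p : ℝ) - κ + 2) (Or.inr hq.le)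
    simp only [id, Real.zero_rpow hq.ne'] at this
    exact this.mono_left nhdsWithin_le_nhds
  · obtain ⟨m, hmq, hnm, hdec⟩ := hφ.exists_isRapidlyDecaying
    -- The smoothness order `m` of `φ` exceeds both `n` and `M + 1 + δ`, which are the thresholds of
    -- the remainder estimate.
    have hrem := isAccurate_windowed_remainder (p := p) hs hg_zero hg_deriv w hnm
      (by rw [hM]; exact hmq) hdec
    rw [hM] at hrem
    have hpart : ∀ j ∈ Finset.range (M + 1),
        IsAccurate n κ p δ (2 * (p : ℝ) - κ + 2 + δ) s w fun x => g x * taylorPart φ j x := by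
      intro j hj
      have hj' : j ≤ M := Nat.lt_succ_iff.1 (Finset.mem_range.1 hj)
      have := IsAccurate.sum (Finset.univ : Finset (Fin j → Fin n)) fun i _ =>
        (isAccurate_monomial hs hp hg_radial hg_zero hg_deriv hc hw (k := countIndex i)
          (by rw [sum_countIndex]; exact hj')).const_mul ((j.factorial : ℝ)⁻¹ *
            iteratedFDeriv ℝ j φ 0 (fun a => EuclideanSpace.single (i a) (1 : ℝ)))
      convert this using 2 with x
      rw [taylorPart_eq_sum_monomial, Finset.mul_sum]
      exact Finset.sum_congr rfl fun i _ => by ring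
    have hacc : IsAccurate n κ p δ (2 * (p : ℝ) - κ + 2 + δ) s w φ := by
      simpa using hrem.add (IsAccurate.sum _ hpart)
    have hset : ∫ x in ({0}ᶜ : Set (E n)), φ x * s x = ∫ x, φ x * s x := by
      rw [restrict_compl_singleton]
    rw [hset]
    refine ⟨hacc.integrable.integrableOn, hacc.summable, ?_⟩
    obtain ⟨C₁, hC₁⟩ := hacc.error
    obtain ⟨B₀, hB₀⟩ := hdec.exists_isSymbol (a := (0 : ℝ)) le_rfl
    obtain ⟨B', hB'⟩ := hdec.exists_isSymbol (a := -δ - 1) (by linarith)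
    obtain ⟨C₂, hC₂, H⟩ := hs.exists_error_bound hnm (a := (0 : ℝ)) (by linarith) (by linarith)
    obtain ⟨-, hb⟩ := H φ B₀ B' hB₀ hB'
    obtain ⟨S, hS⟩ := hdec.decay 0 0 (Nat.zero_le _)
    have hS' : ∀ x, |φ x| ≤ |S| * ‖x‖ ^ (0 : ℝ) := fun x => by
      have := hS x
      simp only [pow_zero, one_mul, norm_iteratedFDeriv_zero, Real.norm_eq_abs] at this
      rw [Real.rpow_zero, mul_one]
      exact this.trans (le_abs_self S)
    obtain ⟨C₃, hC₃, hcorr⟩ := exists_abs_correction_le (δ := δ) w (q := (0 : ℝ))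
    have hB₀0 := hB₀.nonneg
    refine ⟨|C₁| + (C₂ * B₀ + C₃ * |S|) + 1, by positivity, fun h hh => ?_⟩
    have hpos : 0 < h ^ (2 * (p : ℝ) - κ + 2 + δ) := Real.rpow_pos_of_pos hh _
    rcases le_total h 1 with h1 | h1
    · refine (hC₁ h hh h1).trans (mul_le_mul_of_nonneg_right ?_ hpos.le)
      have : 0 ≤ C₂ * B₀ + C₃ * |S| := by positivity
      linarith [le_abs_self C₁]
    -- For `h ≥ 1` no cancellation is needed: treating `φ` as a symbol of order zero bounds the
    -- error by a multiple of `h ^ δ`, and the claimed power of `h` is larger.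
    · have hle : h ^ (0 + δ) ≤ h ^ (2 * (p : ℝ) - κ + 2 + δ) :=
        Real.rpow_le_rpow_of_exponent_le h1 (by linarith)
      have hcrude : |modifiedTrapezoidal n κ p δ w h φ s - ∫ x, φ x * s x| ≤
          (C₂ * B₀ + C₃ * |S|) * h ^ (0 + δ) := by
        rw [modifiedTrapezoidal, add_sub_right_comm, add_mul]
        exact (abs_add_le _ _).trans
          (add_le_add (hb h hh).2 (hcorr φ |S| (abs_nonneg S) hS' h hh))
      refine hcrude.trans ?_
      refine (mul_le_mul_of_nonneg_left hle (by positivity)).trans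
        (mul_le_mul_of_nonneg_right ?_ hpos.le)
      linarith [abs_nonneg C₁]
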